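/- Let $\Bbbk$ be an algebraically closed field of characteristic $0$, and let $P=\Bbbk[x_1,\dots,x_n]$, with its standard grading, carry a quadratic Poisson structure: a $\Bbbk$-bilinear Lie bracket $\{-,-\}$ on $P$ that satisfies the Leibniz rule $\{a,bc\}=\{a,b\}c+b\{a,c\}$ and $\{P_1,P_1\}\subseteq P_2$. Let $U(P)$, with structure maps $\alpha,\beta\colon P\to U(P)$, be the Poisson enveloping algebra of $P$: it is universal among $\Bbbk$-algebras with an algebra homomorphism $\alpha$ and a homomorphism of Lie algebras $\beta$ (for the commutator) from $P$ such that $\alpha(\{a,b\})=\beta(a)\alpha(b)-\alpha(b)\beta(a)$ and $\beta(ab)=\alpha(a)\beta(b)+\alpha(b)\beta(a)$ for all $a,b\in P$. It is graded by giving the generators $\alpha(x_i)$ and $\beta(x_i)$, $1\le i\le n$, degree $1$. Let $\phi$ be a graded Poisson automorphism of $P$ (an algebra automorphism that preserves the bracket, with $\phi(P_d)=P_d$ for all $d$) of finite order, and let $\widetilde\phi$ be the induced graded automorphism of $U(P)$, determined by $\widetilde\phi\circ\alpha=\alpha\circ\phi$ and $\widetilde\phi\circ\beta=\beta\circ\phi$.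 For a graded linear endomorphism $f$ of a graded algebra $A=\bigoplus_{d\ge 0}A_d$ with all $A_d$ finite-dimensional, write $\mathrm{Tr}_A(f,t)=\sum_{d\ge 0}\mathrm{tr}(f|_{A_d})\,t^d\in\Bbbk[[t]]$. Suppose that $\phi|_{P_1}$ has the distinct eigenvalues $\lambda_1,\dots,\lambda_m$, with multiplicities $c_1,\dots,c_m$ (the dimensions of the eigenspaces). Then $$\mathrm{Tr}_{U(P)}(\widetilde\phi,t)=\frac{1}{(1-\lambda_1t)^{2c_1}\cdots(1-\lambda_mt)^{2c_m}}=\bigl(\mathrm{Tr}_P(\phi,t)\bigr)^2 .$$ -/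

import Mathlib

universe u v w

/-- A Poisson bracket on a commutative `k`-algebra `P`: a bilinear alternating bracket which
satisfies the Jacobi identity and the Leibniz rule. -/
structure PoissonStructure (k : Type u) (P : Type v) [CommRing k] [CommRing P] [Algebra k P] where
  /-- the bracket `{a, b}` -/
  bracket : P →ₗ[k] P →ₗ[k] P
  bracket_self : ∀ a, bracket a a = 0
  jacobi : ∀ a b c,
    bracket a (bracket b c) + bracket b (bracket c a) + bracket c (bracket a b) = 0
  leibniz : ∀ a b c, bracket a (b * c) = bracket a b * c + b * bracket a c

namespace PoissonStructure

section Enveloping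

variable {k : Type u} {P : Type v} [CommRing k] [CommRing P] [Algebra k P]

/-- The defining relations of the Poisson enveloping algebra, on the free algebra with one generator
`α a` (written `Sum.inl a`) and one generator `β a` (written `Sum.inr a`) for each `a : P`. -/
inductive EnvelopingRel (B : PoissonStructure k P) :
    FreeAlgebra k (P ⊕ P) → FreeAlgebra k (P ⊕ P) → Prop
  -- `α` is a homomorphism of `k`-algebras
  | alpha_scalar (r : k) :
      EnvelopingRel B (FreeAlgebra.ι k (Sum.inl (algebraMap k P r)))
        (algebraMap k (FreeAlgebra k (P ⊕ P)) r)
  | alpha_add (a b : P) :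
      EnvelopingRel B (FreeAlgebra.ι k (Sum.inl (a + b)))
        (FreeAlgebra.ι k (Sum.inl a) + FreeAlgebra.ι k (Sum.inl b))
  | alpha_mul (a b : P) :
      EnvelopingRel B (FreeAlgebra.ι k (Sum.inl (a * b)))
        (FreeAlgebra.ι k (Sum.inl a) * FreeAlgebra.ι k (Sum.inl b))
  -- `β` is a homomorphism of Lie algebras over `k`, for the commutator bracket
  | beta_add (a b : P) :
      EnvelopingRel B (FreeAlgebra.ι k (Sum.inr (a + b)))
        (FreeAlgebra.ι k (Sum.inr a) + FreeAlgebra.ι k (Sum.inr b))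
  | beta_smul (r : k) (a : P) :
      EnvelopingRel B (FreeAlgebra.ι k (Sum.inr (r • a))) (r • FreeAlgebra.ι k (Sum.inr a))
  | beta_bracket (a b : P) :
      EnvelopingRel B (FreeAlgebra.ι k (Sum.inr (B.bracket a b)))
        (FreeAlgebra.ι k (Sum.inr a) * FreeAlgebra.ι k (Sum.inr b)
          - FreeAlgebra.ι k (Sum.inr b) * FreeAlgebra.ι k (Sum.inr a))
  -- the two compatibilities between `α` and `β`
  | alpha_bracket (a b : P) :
      EnvelopingRel B (FreeAlgebra.ι k (Sum.inl (B.bracket a b)))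
        (FreeAlgebra.ι k (Sum.inr a) * FreeAlgebra.ι k (Sum.inl b)
          - FreeAlgebra.ι k (Sum.inl b) * FreeAlgebra.ι k (Sum.inr a))
  | beta_mul (a b : P) :
      EnvelopingRel B (FreeAlgebra.ι k (Sum.inr (a * b)))
        (FreeAlgebra.ι k (Sum.inl a) * FreeAlgebra.ι k (Sum.inr b)
          + FreeAlgebra.ι k (Sum.inl b) * FreeAlgebra.ι k (Sum.inr a))

/-- The Poisson enveloping algebra `U(P)`; its universal property is `existsUnique_lift` below. -/
abbrev Enveloping (B : PoissonStructure k P) : Type (max u v) :=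
  RingQuot (EnvelopingRel B)

/-- The structure map `α : P → U(P)`, a homomorphism of algebras. -/
noncomputable def alpha (B : PoissonStructure k P) : P →ₐ[k] B.Enveloping :=
  AlgHom.ofLinearMap
    { toFun := fun a => RingQuot.mkAlgHom k (EnvelopingRel B) (FreeAlgebra.ι k (Sum.inl a))
      map_add' := fun a b => by
        rw [RingQuot.mkAlgHom_rel k (EnvelopingRel.alpha_add a b), map_add]
      map_smul' := fun r a => by
        rw [Algebra.smul_def, RingQuot.mkAlgHom_rel k (EnvelopingRel.alpha_mul _ a), map_mul,
          RingQuot.mkAlgHom_rel k (EnvelopingRel.alpha_scalar r), AlgHom.commutes,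
          RingHom.id_apply, Algebra.smul_def] }
    (by
      have h := RingQuot.mkAlgHom_rel k (EnvelopingRel.alpha_scalar (B := B) 1)
      simpa using h)
    (fun a b => by
      have h := RingQuot.mkAlgHom_rel k (EnvelopingRel.alpha_mul (B := B) a b)
      simpa using h)

/-- The structure map `β : P → U(P)`, a homomorphism of Lie algebras. -/
noncomputable def beta (B : PoissonStructure k P) : P →ₗ[k] B.Enveloping where
  toFun a := RingQuot.mkAlgHom k (EnvelopingRel B) (FreeAlgebra.ι k (Sum.inr a))
  map_add' a b := by
    rw [RingQuot.mkAlgHom_rel k (EnvelopingRel.beta_add a b), map_add]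
  map_smul' r a := by
    rw [RingQuot.mkAlgHom_rel k (EnvelopingRel.beta_smul r a), map_smul, RingHom.id_apply]

/-- `(U, α, β)` satisfies the conditions imposed on the Poisson enveloping algebra: the algebra
homomorphism `α` and the linear map `β` are such that `β` is a Lie homomorphism,
`α {a, b} = β a α b - α b β a` and `β (a b) = α a β b + α b β a`. -/
structure IsEnvelopingTriple (B : PoissonStructure k P) {U : Type w} [Ring U] [Algebra k U]
    (α : P →ₐ[k] U) (β : P →ₗ[k] U) : Prop where
  beta_bracket : ∀ a b, β (B.bracket a b) = β a * β b - β b * β a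
  alpha_bracket : ∀ a b, α (B.bracket a b) = β a * α b - α b * β a
  beta_mul : ∀ a b, β (a * b) = α a * β b + α b * β a

theorem isEnvelopingTriple (B : PoissonStructure k P) :
    B.IsEnvelopingTriple B.alpha B.beta where
  beta_bracket a b := by
    have h := RingQuot.mkAlgHom_rel k (EnvelopingRel.beta_bracket (B := B) a b)
    rw [map_sub, map_mul, map_mul] at h
    exact h
  alpha_bracket a b := by
    have h := RingQuot.mkAlgHom_rel k (EnvelopingRel.alpha_bracket (B := B) a b)
    rw [map_sub, map_mul, map_mul] at h
    exact h
  beta_mul a b := by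
    have h := RingQuot.mkAlgHom_rel k (EnvelopingRel.beta_mul (B := B) a b)
    rw [map_add, map_mul, map_mul] at h
    exact h

/-- The homomorphism `U(P) → U'` given by the universal property. -/
noncomputable def lift (B : PoissonStructure k P) {U : Type w} [Ring U] [Algebra k U]
    (α : P →ₐ[k] U) (β : P →ₗ[k] U) (h : B.IsEnvelopingTriple α β) : B.Enveloping →ₐ[k] U :=
  RingQuot.liftAlgHom k ⟨FreeAlgebra.lift k (Sum.elim α β), fun x y hxy => by
    cases hxy with
    | alpha_scalar r => simp
    | alpha_add a b => simp
    | alpha_mul a b => simp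
    | beta_add a b => simp
    | beta_smul r a => simp
    | beta_bracket a b => simp [h.beta_bracket]
    | alpha_bracket a b => simp [h.alpha_bracket]
    | beta_mul a b => simp [h.beta_mul]⟩

theorem lift_alpha (B : PoissonStructure k P) {U : Type w} [Ring U] [Algebra k U]
    (α : P →ₐ[k] U) (β : P →ₗ[k] U) (h : B.IsEnvelopingTriple α β) (a : P) :
    B.lift α β h (B.alpha a) = α a := by
  change RingQuot.liftAlgHom k _ (RingQuot.mkAlgHom k (EnvelopingRel B) _) = _
  rw [RingQuot.liftAlgHom_mkAlgHom_apply]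
  simp

theorem lift_beta (B : PoissonStructure k P) {U : Type w} [Ring U] [Algebra k U]
    (α : P →ₐ[k] U) (β : P →ₗ[k] U) (h : B.IsEnvelopingTriple α β) (a : P) :
    B.lift α β h (B.beta a) = β a := by
  change RingQuot.liftAlgHom k _ (RingQuot.mkAlgHom k (EnvelopingRel B) _) = _
  rw [RingQuot.liftAlgHom_mkAlgHom_apply]
  simp

theorem hom_ext (B : PoissonStructure k P) {U : Type w} [Ring U] [Algebra k U]
    {f g : B.Enveloping →ₐ[k] U} (hα : ∀ a, f (B.alpha a) = g (B.alpha a))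
    (hβ : ∀ a, f (B.beta a) = g (B.beta a)) : f = g := by
  apply RingQuot.ringQuot_ext'
  apply FreeAlgebra.hom_ext
  funext x
  rcases x with a | a
  · exact hα a
  · exact hβ a

/-- The universal property of the Poisson enveloping algebra. -/
theorem existsUnique_lift (B : PoissonStructure k P) {U : Type w} [Ring U] [Algebra k U]
    (α : P →ₐ[k] U) (β : P →ₗ[k] U) (h : B.IsEnvelopingTriple α β) :
    ∃! f : B.Enveloping →ₐ[k] U,
      (∀ a, f (B.alpha a) = α a) ∧ ∀ a, f (B.beta a) = β a :=
  ⟨B.lift α β h, ⟨B.lift_alpha α β h, B.lift_beta α β h⟩, fun _ hg =>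
    B.hom_ext (fun a => (hg.1 a).trans (B.lift_alpha α β h a).symm)
      (fun a => (hg.2 a).trans (B.lift_beta α β h a).symm)⟩

/-- A Poisson automorphism: an algebra automorphism that preserves the bracket. -/
def IsPoissonAut (B : PoissonStructure k P) (φ : P ≃ₐ[k] P) : Prop :=
  ∀ a b, φ (B.bracket a b) = B.bracket (φ a) (φ b)

theorem IsPoissonAut.symm {B : PoissonStructure k P} {φ : P ≃ₐ[k] P} (h : B.IsPoissonAut φ) :
    B.IsPoissonAut φ.symm := fun a b => by
  apply φ.injective
  rw [h]
  simp

theorem IsPoissonAut.isEnvelopingTriple {B : PoissonStructure k P} {φ : P ≃ₐ[k] P}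
    (h : B.IsPoissonAut φ) :
    B.IsEnvelopingTriple (B.alpha.comp (φ : P →ₐ[k] P)) (B.beta.comp φ.toLinearMap) where
  beta_bracket a b := by simp [h a b, B.isEnvelopingTriple.beta_bracket]
  alpha_bracket a b := by simp [h a b, B.isEnvelopingTriple.alpha_bracket]
  beta_mul a b := by simp [B.isEnvelopingTriple.beta_mul]

/-- The endomorphism `φ̃` of `U(P)` with `φ̃ ∘ α = α ∘ φ` and `φ̃ ∘ β = β ∘ φ`. -/
noncomputable def inducedHom (B : PoissonStructure k P) (φ : P ≃ₐ[k] P) (h : B.IsPoissonAut φ) :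
    B.Enveloping →ₐ[k] B.Enveloping :=
  B.lift (B.alpha.comp (φ : P →ₐ[k] P)) (B.beta.comp φ.toLinearMap) h.isEnvelopingTriple

theorem inducedHom_alpha (B : PoissonStructure k P) (φ : P ≃ₐ[k] P) (h : B.IsPoissonAut φ)
    (a : P) : B.inducedHom φ h (B.alpha a) = B.alpha (φ a) :=
  B.lift_alpha _ _ _ a

theorem inducedHom_beta (B : PoissonStructure k P) (φ : P ≃ₐ[k] P) (h : B.IsPoissonAut φ)
    (a : P) : B.inducedHom φ h (B.beta a) = B.beta (φ a) :=
  B.lift_beta _ _ _ a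

/-- The automorphism `φ̃` of `U(P)` induced by a Poisson automorphism `φ` of `P`. -/
noncomputable def inducedAut (B : PoissonStructure k P) (φ : P ≃ₐ[k] P) (h : B.IsPoissonAut φ) :
    B.Enveloping ≃ₐ[k] B.Enveloping :=
  AlgEquiv.ofAlgHom (B.inducedHom φ h) (B.inducedHom φ.symm h.symm)
    (B.hom_ext (fun a => by simp [inducedHom_alpha]) (fun a => by simp [inducedHom_beta]))
    (B.hom_ext (fun a => by simp [inducedHom_alpha]) (fun a => by simp [inducedHom_beta]))

theorem inducedAut_alpha (B : PoissonStructure k P) (φ : P ≃ₐ[k] P) (h : B.IsPoissonAut φ)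
    (a : P) : B.inducedAut φ h (B.alpha a) = B.alpha (φ a) :=
  B.inducedHom_alpha φ h a

theorem inducedAut_beta (B : PoissonStructure k P) (φ : P ≃ₐ[k] P) (h : B.IsPoissonAut φ)
    (a : P) : B.inducedAut φ h (B.beta a) = B.beta (φ a) :=
  B.inducedHom_beta φ h a

end Enveloping

section Graded

variable {k : Type u} [Field k] {n : ℕ}

/-- The degree `d` component `P_d` of `P = k[x_1, …, x_n]` in the standard grading. -/
noncomputable abbrev polyGrading (k : Type u) [Field k] (n d : ℕ) :
    Submodule k (MvPolynomial (Fin n) k) :=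
  MvPolynomial.homogeneousSubmodule (Fin n) k d

/-- A Poisson structure on `k[x_1, …, x_n]` is quadratic if `{P_1, P_1} ⊆ P_2`. -/
def IsQuadratic (B : PoissonStructure k (MvPolynomial (Fin n) k)) : Prop :=
  ∀ f ∈ polyGrading k n 1, ∀ g ∈ polyGrading k n 1, B.bracket f g ∈ polyGrading k n 2

/-- A graded Poisson automorphism: a Poisson automorphism with `φ(P_d) = P_d` for all `d`. -/
structure IsGradedPoissonAut (B : PoissonStructure k (MvPolynomial (Fin n) k))
    (φ : MvPolynomial (Fin n) k ≃ₐ[k] MvPolynomial (Fin n) k) : Prop where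
  isPoissonAut : B.IsPoissonAut φ
  map_grading : ∀ d, (polyGrading k n d).map φ.toLinearMap = polyGrading k n d

theorem IsGradedPoissonAut.mem {B : PoissonStructure k (MvPolynomial (Fin n) k)}
    {φ : MvPolynomial (Fin n) k ≃ₐ[k] MvPolynomial (Fin n) k} (h : B.IsGradedPoissonAut φ)
    (d : ℕ) : ∀ f ∈ polyGrading k n d, φ.toLinearMap f ∈ polyGrading k n d := fun f hf => by
  rw [← h.map_grading d]
  exact Submodule.mem_map_of_mem hf

/-- The degree `d` component `U(P)_d`, for the grading in which `x_i = α(x_i)` and `y_i = β(x_i)`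
have degree one: the span of the words of length `d` in these `2n` generators, i.e. the `d`-th
power (as a subspace of the algebra `U(P)`) of the subspace spanned by the generators. -/
noncomputable def envGrading (B : PoissonStructure k (MvPolynomial (Fin n) k)) (d : ℕ) :
    Submodule k B.Enveloping :=
  (Submodule.span k (Set.range (fun i : Fin n => B.alpha (MvPolynomial.X i)) ∪
    Set.range (fun i : Fin n => B.beta (MvPolynomial.X i)))) ^ d

/-- The components `U(P)_d` are finite-dimensional. -/
theorem finiteDimensional_envGrading (B : PoissonStructure k (MvPolynomial (Fin n) k)) (d : ℕ) :
    FiniteDimensional k (B.envGrading d) := by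
  refine Module.Finite.iff_fg.mpr (Submodule.FG.pow (Submodule.fg_span ?_) d)
  exact (Set.finite_range _).union (Set.finite_range _)

/-- Linear forms are combinations of the variables. -/
theorem mem_span_X_of_mem_one {f : MvPolynomial (Fin n) k} (hf : f ∈ polyGrading k n 1) :
    f ∈ Submodule.span k (Set.range (MvPolynomial.X : Fin n → MvPolynomial (Fin n) k)) := by
  rwa [← MvPolynomial.homogeneousSubmodule_one_eq_span_X]

/-- The induced automorphism `φ̃` preserves the grading of `U(P)`. -/
theorem IsGradedPoissonAut.inducedAut_mem {B : PoissonStructure k (MvPolynomial (Fin n) k)}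
    {φ : MvPolynomial (Fin n) k ≃ₐ[k] MvPolynomial (Fin n) k} (h : B.IsGradedPoissonAut φ)
    (d : ℕ) : ∀ u ∈ B.envGrading d,
      (B.inducedAut φ h.isPoissonAut).toLinearMap u ∈ B.envGrading d := by
  intro u hu
  have hX : ∀ i : Fin n, φ (MvPolynomial.X i) ∈
      Submodule.span k (Set.range (MvPolynomial.X : Fin n → MvPolynomial (Fin n) k)) := fun i =>
    mem_span_X_of_mem_one (h.mem 1 _
      ((MvPolynomial.mem_homogeneousSubmodule 1 _).2 (MvPolynomial.isHomogeneous_X k i)))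
  set V := Submodule.span k (Set.range (fun i : Fin n => B.alpha (MvPolynomial.X i)) ∪
    Set.range (fun i : Fin n => B.beta (MvPolynomial.X i))) with hV
  have hα : Submodule.span k (Set.range (MvPolynomial.X : Fin n → MvPolynomial (Fin n) k)) ≤
      V.comap B.alpha.toLinearMap := by
    rw [Submodule.span_le]
    rintro _ ⟨i, rfl⟩
    exact Submodule.subset_span (Or.inl ⟨i, rfl⟩)
  have hβ : Submodule.span k (Set.range (MvPolynomial.X : Fin n → MvPolynomial (Fin n) k)) ≤
      V.comap B.beta := by
    rw [Submodule.span_le]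
    rintro _ ⟨i, rfl⟩
    exact Submodule.subset_span (Or.inr ⟨i, rfl⟩)
  have hle : V.map (B.inducedAut φ h.isPoissonAut : B.Enveloping →ₐ[k] B.Enveloping).toLinearMap
      ≤ V := by
    rw [hV, Submodule.map_span_le]
    rintro _ (⟨i, rfl⟩ | ⟨i, rfl⟩)
    · change B.inducedAut φ h.isPoissonAut (B.alpha (MvPolynomial.X i)) ∈ V
      rw [inducedAut_alpha]
      exact hα (hX i)
    · change B.inducedAut φ h.isPoissonAut (B.beta (MvPolynomial.X i)) ∈ V
      rw [inducedAut_beta]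
      exact hβ (hX i)
  have hpow := pow_le_pow_left' hle d
  rw [← Submodule.map_pow] at hpow
  exact hpow (Submodule.mem_map_of_mem hu)

/-- The trace series `∑_d tr(f|_{A_d}) t^d` of a linear map `f` that preserves each of the
subspaces `A_d`. -/
noncomputable def traceSeries {A : Type v} [Ring A] [Algebra k A] (𝒜 : ℕ → Submodule k A)
    (f : A →ₗ[k] A) (hf : ∀ d, ∀ a ∈ 𝒜 d, f a ∈ 𝒜 d) : PowerSeries k :=
  PowerSeries.mk fun d => LinearMap.trace k (𝒜 d) (f.restrict (hf d))

end Graded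

end PoissonStructure

/-! The trace formula rests on a Poincaré–Birkhoff–Witt theorem: for any basis `v_i` of `P_1`, the
products of a monomial in the `α(v_i)` with an ordered monomial in the `β(v_i)` form a basis of
`U(P)`, and those of total length `d` form a basis of `U(P)_d`. Since `φ` has finite order in
characteristic 0, the `v_i` can be chosen as eigenvectors of `φ`. Every such product is then an
eigenvector of `φ̃`, its eigenvalue being the product of those of its factors. So the trace series
is a product of `2n` geometric series, each eigenvalue on `P_1` counted twice; the same computation
on `P` uses each once.

Spanning holds because the relations allow reordering. For independence, `U(P)` is made to act on
the free `P`-module with basis the commutative monomials `y^J`. The operator of `β(x_i)` is defined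
by recursion on the degree in `y`, as reordering dictates, and the commutation relations are checked
by the induction of the classical PBW proof, with the Jacobi identity closing the critical case
(`IsQuadratic.commutesOn_single`). Acting on `y^0` recovers a normally ordered product from its
value in `U(P)` (`IsQuadratic.action_normalOrder`). The case of a general basis follows by
transporting the bracket along the linear change of variables. -/

namespace PoissonStructure

/-! ### The module of normally ordered products and its bidegree filtration. -/

section NormalModule

open MvPolynomial

variable {k : Type u} [Field k] {n : ℕ}

/-- The free `k[x_1, …, x_n]`-module on the commutative monomials in `n` further variables `y_i`; it
carries the action of `U(P)` by left multiplication on normally ordered products. -/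
abbrev NormalModule (k : Type u) [Field k] (n : ℕ) : Type u :=
  Multiset (Fin n) →₀ MvPolynomial (Fin n) k

/-- The additive map with `a y^J ↦ a e(y^J) + D(a) y^J`. -/
noncomputable def leibnizExtend (D : MvPolynomial (Fin n) k →ₗ[k] MvPolynomial (Fin n) k)
    (e : Multiset (Fin n) → NormalModule k n) : NormalModule k n →ₗ[k] NormalModule k n :=
  Finsupp.lsum k fun J =>
    (LinearMap.toSpanSingleton (MvPolynomial (Fin n) k) (NormalModule k n) (e J)).restrictScalars k
      + (Finsupp.lsingle J : MvPolynomial (Fin n) k →ₗ[k] NormalModule k n) ∘ₗ D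

theorem leibnizExtend_single (D : MvPolynomial (Fin n) k →ₗ[k] MvPolynomial (Fin n) k)
    (e : Multiset (Fin n) → NormalModule k n) (J : Multiset (Fin n)) (a : MvPolynomial (Fin n) k) :
    leibnizExtend D e (Finsupp.single J a) = a • e J + Finsupp.single J (D a) := by
  simp [leibnizExtend]

/-- For `D = {x_i, -}` this is the relation `β(x_i) α(a) = α(a) β(x_i) + α({x_i, a})` at the level
of operators. -/
theorem leibnizExtend_smul (D : MvPolynomial (Fin n) k →ₗ[k] MvPolynomial (Fin n) k)
    (hD : ∀ a b, D (a * b) = D a * b + a * D b)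
    (e : Multiset (Fin n) → NormalModule k n) (a : MvPolynomial (Fin n) k) (m : NormalModule k n) :
    leibnizExtend D e (a • m) = a • leibnizExtend D e m + D a • m := by
  induction m using Finsupp.induction_linear with
  | zero => simp
  | add x y hx hy => rw [smul_add, map_add, hx, hy, map_add, smul_add, smul_add]; abel
  | single J b =>
    rw [Finsupp.smul_single, leibnizExtend_single, leibnizExtend_single, smul_eq_mul, hD,
      smul_add, Finsupp.smul_single, Finsupp.smul_single, smul_eq_mul, smul_eq_mul, mul_smul,
      Finsupp.single_add]
    abel

/-- The span of the `a y^J` of total degree `d` and of degree at most `c` in the `y_i`. -/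
noncomputable def totalDegreeLE (k : Type u) [Field k] (n d c : ℕ) :
    Submodule k (NormalModule k n) :=
  Submodule.span k {m | ∃ (J : Multiset (Fin n)) (r : ℕ) (a : MvPolynomial (Fin n) k),
    a ∈ polyGrading k n r ∧ r + J.card = d ∧ J.card ≤ c ∧ m = Finsupp.single J a}

theorem single_mem_totalDegreeLE {d c r : ℕ} {J : Multiset (Fin n)} {a : MvPolynomial (Fin n) k}
    (ha : a ∈ polyGrading k n r) (hd : r + J.card = d) (hc : J.card ≤ c) :
    Finsupp.single J a ∈ totalDegreeLE k n d c :=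
  Submodule.subset_span ⟨J, r, a, ha, hd, hc, rfl⟩

theorem one_mem_polyGrading : (1 : MvPolynomial (Fin n) k) ∈ polyGrading k n 0 :=
  isHomogeneous_one _ _

theorem totalDegreeLE_mono {d c c' : ℕ} (h : c ≤ c') :
    totalDegreeLE k n d c ≤ totalDegreeLE k n d c' := by
  refine Submodule.span_mono ?_
  rintro _ ⟨J, r, a, ha, hd, hc, rfl⟩
  exact ⟨J, r, a, ha, hd, hc.trans h, rfl⟩

theorem smul_mem_totalDegreeLE {d c r : ℕ} {a : MvPolynomial (Fin n) k}
    (ha : a ∈ polyGrading k n r) {m : NormalModule k n} (hm : m ∈ totalDegreeLE k n d c) :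
    a • m ∈ totalDegreeLE k n (d + r) c := by
  induction hm using Submodule.span_induction with
  | zero => simp
  | add x y _ _ hx hy => rw [smul_add]; exact add_mem hx hy
  | smul t x _ hx => rw [smul_comm]; exact Submodule.smul_mem _ _ hx
  | mem x hx =>
    obtain ⟨J, s, b, hb, hd, hc, rfl⟩ := hx
    rw [Finsupp.smul_single, smul_eq_mul]
    exact single_mem_totalDegreeLE (r := r + s) (IsHomogeneous.mul ha hb) (by omega) hc

theorem leibnizExtend_mem {D : MvPolynomial (Fin n) k →ₗ[k] MvPolynomial (Fin n) k}
    (hD : ∀ r, ∀ a ∈ polyGrading k n r, D a ∈ polyGrading k n (r + 1))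
    {e : Multiset (Fin n) → NormalModule k n} {d c : ℕ}
    (he : ∀ J, J.card ≤ c → e J ∈ totalDegreeLE k n (J.card + 1) (J.card + 1))
    {m : NormalModule k n} (hm : m ∈ totalDegreeLE k n d c) :
    leibnizExtend D e m ∈ totalDegreeLE k n (d + 1) (c + 1) := by
  induction hm using Submodule.span_induction with
  | zero => simp
  | add x y _ _ hx hy => rw [map_add]; exact add_mem hx hy
  | smul t x _ hx => rw [map_smul]; exact Submodule.smul_mem _ _ hx
  | mem x hx =>
    obtain ⟨J, s, b, hb, hd, hc, rfl⟩ := hx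
    rw [leibnizExtend_single]
    refine add_mem ?_ (single_mem_totalDegreeLE (hD _ _ hb) (by omega) (by omega))
    have h := smul_mem_totalDegreeLE hb (he J hc)
    rw [show J.card + 1 + s = d + 1 by omega] at h
    exact totalDegreeLE_mono (by omega) h

/-- Only the values of `e` on monomials of `y`-degree at most `c` enter. This allows the recursion
depth of `normalForm` to be changed without affecting the result. -/
theorem leibnizExtend_congr {D : MvPolynomial (Fin n) k →ₗ[k] MvPolynomial (Fin n) k}
    {e e' : Multiset (Fin n) → NormalModule k n} {d c : ℕ}
    (he : ∀ J, J.card ≤ c → e J = e' J)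
    {m : NormalModule k n} (hm : m ∈ totalDegreeLE k n d c) :
    leibnizExtend D e m = leibnizExtend D e' m := by
  induction hm using Submodule.span_induction with
  | zero => simp
  | add x y _ _ hx hy => rw [map_add, hx, hy, map_add]
  | smul t x _ hx => rw [map_smul, hx, map_smul]
  | mem x hx =>
    obtain ⟨J, s, b, hb, hd, hc, rfl⟩ := hx
    rw [leibnizExtend_single, leibnizExtend_single, he J hc]

/-- The case split behind the inductions below: either `y_i y^J` is already ordered, or the least
variable `y_l` of `y^J` has to be moved past `y_i`. -/
theorem forall_le_or_exists_cons (i : Fin n) (J : Multiset (Fin n)) :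
    (∀ x ∈ J, i ≤ x) ∨ ∃ l K, J = l ::ₘ K ∧ l < i ∧ ∀ x ∈ K, l ≤ x := by
  have hs := J.pairwise_sort (· ≤ ·)
  have he := J.sort_eq (· ≤ ·)
  revert hs he
  cases J.sort (· ≤ ·) with
  | nil =>
    intro _ he
    left
    rw [← he]
    simp
  | cons l L =>
    intro hs he
    rw [List.pairwise_cons] at hs
    rw [← Multiset.cons_coe] at he
    by_cases h : i ≤ l
    · left
      rw [← he]
      intro x hx
      rcases Multiset.mem_cons.1 hx with rfl | hx
      · exact h
      · exact h.trans (hs.1 x hx)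
    · exact Or.inr ⟨l, L, he.symm, not_le.1 h, hs.1⟩

/-! ### Poisson brackets in terms of partial derivatives. -/

variable (B : PoissonStructure k (MvPolynomial (Fin n) k))

theorem bracket_skew {P : Type v} [CommRing P] [Algebra k P] (B : PoissonStructure k P) (a b : P) :
    B.bracket a b = -B.bracket b a := by
  have h := B.bracket_self (a + b)
  simp only [map_add, LinearMap.add_apply, B.bracket_self, zero_add, add_zero] at h
  exact eq_neg_of_add_eq_zero_left (by rw [add_comm]; exact h)

/-- The derivation `{a, -}`. -/
noncomputable def hamiltonian (a : MvPolynomial (Fin n) k) :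
    Derivation k (MvPolynomial (Fin n) k) (MvPolynomial (Fin n) k) :=
  Derivation.mk' (B.bracket a) fun b c => by
    rw [B.leibniz, smul_eq_mul, smul_eq_mul]; ring

theorem hamiltonian_apply (a b : MvPolynomial (Fin n) k) :
    B.hamiltonian a b = B.bracket a b := rfl

theorem derivation_sum_apply {ι : Type*} (s : Finset ι)
    (D : ι → Derivation k (MvPolynomial (Fin n) k) (MvPolynomial (Fin n) k))
    (a : MvPolynomial (Fin n) k) : (∑ p ∈ s, D p) a = ∑ p ∈ s, D p a := by
  have h := map_sum (Derivation.coeFnAddMonoidHom (R := k) (A := MvPolynomial (Fin n) k)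
    (M := MvPolynomial (Fin n) k)) D s
  exact (congrFun h a).trans (Finset.sum_apply _ _ _)

/-- Both sides are derivations in `b`, and they agree on the variables. -/
theorem bracket_eq_sum_right (a b : MvPolynomial (Fin n) k) :
    B.bracket a b = ∑ p, pderiv p b * B.bracket a (X p) := by
  have h : B.hamiltonian a = ∑ p, B.bracket a (X p) • pderiv p := by
    refine derivation_ext fun i => ?_
    rw [hamiltonian_apply, derivation_sum_apply, Finset.sum_eq_single i]
    · simp
    · intro p _ hp
      simp [pderiv_X_of_ne hp.symm]
    · simp
  have h' := congrArg (fun D => D b) h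
  simp only [hamiltonian_apply, derivation_sum_apply] at h'
  rw [h']
  exact Finset.sum_congr rfl fun p _ => mul_comm _ _

theorem bracket_eq_sum_left (a b : MvPolynomial (Fin n) k) :
    B.bracket a b = ∑ p, pderiv p a * B.bracket (X p) b := by
  rw [B.bracket_skew, bracket_eq_sum_right B b a, ← Finset.sum_neg_distrib]
  exact Finset.sum_congr rfl fun p _ => by rw [B.bracket_skew b, mul_neg, neg_neg]

theorem pderiv_comm (p q : Fin n) (a : MvPolynomial (Fin n) k) :
    pderiv p (pderiv q a) = pderiv q (pderiv p a) := by
  have h : ⁅(pderiv p : Derivation k (MvPolynomial (Fin n) k) (MvPolynomial (Fin n) k)),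
      (pderiv q : Derivation k (MvPolynomial (Fin n) k) (MvPolynomial (Fin n) k))⁆ = 0 := by
    refine derivation_ext fun i => ?_
    classical
    rw [Derivation.commutator_apply, pderiv_X, pderiv_X]
    simp only [Pi.single_apply]
    split_ifs <;> simp
  have h' := congrArg (fun D => D a) h
  simp only [Derivation.commutator_apply, Derivation.zero_apply] at h'
  exact sub_eq_zero.1 h'

theorem pderiv_bracket (q : Fin n) (a b : MvPolynomial (Fin n) k) :
    pderiv q (B.bracket a b) =
      B.bracket a (pderiv q b) + ∑ p, pderiv p b * pderiv q (B.bracket a (X p)) := by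
  rw [bracket_eq_sum_right B a b, bracket_eq_sum_right B a (pderiv q b), map_sum,
    ← Finset.sum_add_distrib]
  refine Finset.sum_congr rfl fun p _ => ?_
  rw [pderiv_mul, pderiv_comm q p]

variable {B}

theorem IsQuadratic.bracket_X_mem (hB : B.IsQuadratic) (i : Fin n) (r : ℕ) :
    ∀ a ∈ polyGrading k n r, B.bracket (X i) a ∈ polyGrading k n (r + 1) := by
  intro a ha
  rw [bracket_eq_sum_right]
  refine sum_mem fun p _ => ?_
  -- A derivative has degree `r - 1` with truncated subtraction, so constants need a separate
  -- argument.
  rcases Nat.eq_zero_or_pos r with rfl | hr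
  · rw [mem_homogeneousSubmodule] at ha
    rw [(totalDegree_eq_zero_iff_eq_C.1 ((totalDegree_zero_iff_isHomogeneous _).2 ha)), pderiv_C,
      zero_mul]
    exact zero_mem _
  · have h := IsHomogeneous.mul (IsHomogeneous.pderiv (i := p) ha)
      (hB _ (isHomogeneous_X k i) _ (isHomogeneous_X k p))
    rwa [show r - 1 + 2 = r + 1 by omega] at h

theorem IsQuadratic.pderiv_bracket_mem (hB : B.IsQuadratic) (p i j : Fin n) :
    pderiv p (B.bracket (X i) (X j)) ∈ polyGrading k n 1 :=
  IsHomogeneous.pderiv (hB _ (isHomogeneous_X k i) _ (isHomogeneous_X k j))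

/-! ### The recursive normal form of `y_i y^J`. -/

variable (B)

/-- The normal form of `y_i y^J`, computed with at most `d` nested uses of the commutation
relations; it is independent of `d` once `d` is at least the degree of `y^J`. -/
noncomputable def normalForm : ℕ → Fin n → Multiset (Fin n) → NormalModule k n
  | 0, i, J => Finsupp.single (i ::ₘ J) 1
  | d + 1, i, J =>
    match J.sort (· ≤ ·) with
    | [] => Finsupp.single (i ::ₘ J) 1
    | l :: L =>
      if i ≤ l then Finsupp.single (i ::ₘ J) 1
      -- Here `y_i y_l y^L = y_l (y_i y^L) + β({x_i, x_l}) y^L`. The leading term of `y_i y^L` is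
      -- the monomial `y_i · y^L`, on which `y_l` acts without reordering because `l` is least. It
      -- is subtracted so that `normalForm d l` is only needed on monomials of degree at most that
      -- of `y^L`.
      else Finsupp.single (i ::ₘ J) 1
        + leibnizExtend (B.bracket (X l)) (normalForm d l)
            (normalForm d i L - Finsupp.single (i ::ₘ (L : Multiset (Fin n))) 1)
        + ∑ p, pderiv p (B.bracket (X i) (X l)) • normalForm d p L

theorem normalForm_of_le (d : ℕ) {i : Fin n} {J : Multiset (Fin n)} (h : ∀ x ∈ J, i ≤ x) :
    B.normalForm d i J = Finsupp.single (i ::ₘ J) 1 := by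
  cases d with
  | zero => rfl
  | succ d =>
    rw [normalForm]
    split
    · rfl
    · rename_i l L hL
      rw [if_pos (h l ?_)]
      rw [← Multiset.mem_sort (r := (· ≤ ·)), hL]
      exact List.mem_cons_self

theorem normalForm_cons (d : ℕ) {i l : Fin n} {K : Multiset (Fin n)} (hl : l < i)
    (h : ∀ x ∈ K, l ≤ x) :
    B.normalForm (d + 1) i (l ::ₘ K) = Finsupp.single (i ::ₘ l ::ₘ K) 1
      + leibnizExtend (B.bracket (X l)) (B.normalForm d l)
          (B.normalForm d i K - Finsupp.single (i ::ₘ K) 1)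
      + ∑ p, pderiv p (B.bracket (X i) (X l)) • B.normalForm d p K := by
  rw [normalForm, Multiset.sort_cons _ _ _ h]
  simp only [if_neg (not_le.2 hl), Multiset.sort_eq]

variable {B}

theorem single_cons_mem (i : Fin n) (J : Multiset (Fin n)) :
    (Finsupp.single (i ::ₘ J) 1 : NormalModule k n) ∈
      totalDegreeLE k n (J.card + 1) (J.card + 1) :=
  single_mem_totalDegreeLE one_mem_polyGrading (by simp) (by simp)

/-- The two claims need one induction: the bound on the lower terms guarantees that the inner
recursion only meets monomials for which depth `d` already suffices. -/
theorem IsQuadratic.normalForm_spec (hB : B.IsQuadratic) (d : ℕ) :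
    ∀ (J : Multiset (Fin n)), J.card ≤ d → ∀ i,
      B.normalForm d i J - Finsupp.single (i ::ₘ J) 1 ∈ totalDegreeLE k n (J.card + 1) J.card ∧
      B.normalForm (d + 1) i J = B.normalForm d i J := by
  induction d with
  | zero =>
    intro J hJ i
    obtain rfl : J = 0 := Multiset.card_eq_zero.1 (by omega)
    rw [normalForm_of_le B _ (by simp), normalForm_of_le B _ (by simp)]
    simp
  | succ d ih =>
    intro J hJ i
    rcases forall_le_or_exists_cons i J with h | ⟨l, K, rfl, hl, h⟩
    · rw [normalForm_of_le B _ h, normalForm_of_le B _ h]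
      simp
    · rw [Multiset.card_cons] at hJ ⊢
      have hK : K.card ≤ d := by omega
      have hmem : ∀ J : Multiset (Fin n), J.card ≤ d → ∀ i,
          B.normalForm d i J ∈ totalDegreeLE k n (J.card + 1) (J.card + 1) := fun J hJ i => by
        have h1 := add_mem (totalDegreeLE_mono (Nat.le_succ _) (ih J hJ i).1) (single_cons_mem i J)
        rwa [sub_add_cancel] at h1
      rw [normalForm_cons B d hl h, normalForm_cons B (d + 1) hl h]
      constructor
      · rw [add_assoc (Finsupp.single _ _), add_sub_cancel_left]
        refine add_mem (leibnizExtend_mem (hB.bracket_X_mem l)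
          (fun J hJ => hmem J (hJ.trans hK) l) (ih K hK i).1) (sum_mem fun p _ => ?_)
        exact smul_mem_totalDegreeLE (hB.pderiv_bracket_mem p i l) (hmem K hK p)
      · rw [(ih K hK i).2, leibnizExtend_congr (fun J hJ => (ih J (hJ.trans hK) l).2) (ih K hK i).1]
        simp only [(ih K hK _).2]

theorem IsQuadratic.normalForm_eq (hB : B.IsQuadratic) {d : ℕ} {J : Multiset (Fin n)}
    (h : J.card ≤ d) (i : Fin n) : B.normalForm d i J = B.normalForm J.card i J := by
  induction d, h using Nat.le_induction with
  | base => rfl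
  | succ d hd ih => rw [(hB.normalForm_spec d J hd i).2, ih]

/-! ### The operators of `β(x_i)` and `β(a)`. -/

variable (B)

/-- The action of `β(x_i)` on the normally ordered products. -/
noncomputable def betaOp (i : Fin n) : NormalModule k n →ₗ[k] NormalModule k n :=
  leibnizExtend (B.bracket (X i)) fun J => B.normalForm J.card i J

theorem betaOp_smul (i : Fin n) (a : MvPolynomial (Fin n) k) (m : NormalModule k n) :
    B.betaOp i (a • m) = a • B.betaOp i m + B.bracket (X i) a • m :=
  leibnizExtend_smul _ (B.leibniz _) _ _ _

theorem bracket_one (a : MvPolynomial (Fin n) k) : B.bracket a 1 = 0 :=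
  (B.hamiltonian a).map_one_eq_zero

theorem betaOp_single_one (i : Fin n) (J : Multiset (Fin n)) :
    B.betaOp i (Finsupp.single J 1) = B.normalForm J.card i J := by
  rw [betaOp, leibnizExtend_single, bracket_one, one_smul, Finsupp.single_zero, add_zero]

theorem betaOp_single_of_le {i : Fin n} {J : Multiset (Fin n)} (h : ∀ x ∈ J, i ≤ x) :
    B.betaOp i (Finsupp.single J 1) = Finsupp.single (i ::ₘ J) 1 := by
  rw [betaOp_single_one, normalForm_of_le B _ h]

/-- The action of `β(a)` on the normally ordered products. -/
noncomputable def betaAction : MvPolynomial (Fin n) k →ₗ[k] Module.End k (NormalModule k n) :=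
  ∑ p, (LinearMap.toSpanSingleton (MvPolynomial (Fin n) k) (Module.End k (NormalModule k n))
    (B.betaOp p)).restrictScalars k ∘ₗ (pderiv p).toLinearMap

theorem betaAction_apply (a : MvPolynomial (Fin n) k) (m : NormalModule k n) :
    B.betaAction a m = ∑ p, pderiv p a • B.betaOp p m := by
  simp [betaAction, LinearMap.sum_apply]

theorem betaAction_X (i : Fin n) (m : NormalModule k n) :
    B.betaAction (X i) m = B.betaOp i m := by
  rw [betaAction_apply, Finset.sum_eq_single i]
  · simp
  · intro p _ hp
    simp [pderiv_X_of_ne hp.symm]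
  · simp

theorem betaAction_smul (a b : MvPolynomial (Fin n) k) (m : NormalModule k n) :
    B.betaAction a (b • m) = b • B.betaAction a m + B.bracket a b • m := by
  rw [bracket_eq_sum_left, betaAction_apply, betaAction_apply, Finset.smul_sum, Finset.sum_smul,
    ← Finset.sum_add_distrib]
  refine Finset.sum_congr rfl fun p _ => ?_
  rw [betaOp_smul, smul_add, smul_comm, smul_smul (pderiv p a)]

variable {B}

theorem IsQuadratic.betaOp_sub_mem (hB : B.IsQuadratic) (i : Fin n) (J : Multiset (Fin n)) :
    B.betaOp i (Finsupp.single J 1) - Finsupp.single (i ::ₘ J) 1 ∈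
      totalDegreeLE k n (J.card + 1) J.card := by
  rw [betaOp_single_one]
  exact (hB.normalForm_spec _ J le_rfl i).1

theorem IsQuadratic.betaOp_mem (hB : B.IsQuadratic) (i : Fin n) {d c : ℕ}
    {m : NormalModule k n} (hm : m ∈ totalDegreeLE k n d c) :
    B.betaOp i m ∈ totalDegreeLE k n (d + 1) (c + 1) := by
  refine leibnizExtend_mem (hB.bracket_X_mem i) (fun J _ => ?_) hm
  have h1 := add_mem (totalDegreeLE_mono (Nat.le_succ _) (hB.normalForm_spec _ J le_rfl i).1)
    (single_cons_mem i J)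
  rwa [sub_add_cancel] at h1

/-- The recursion for `normalForm`, freed of its depth: the subtracted leading term is restored as
the image under `betaOp l` of an ordered monomial. -/
theorem IsQuadratic.betaOp_single_cons (hB : B.IsQuadratic) {i l : Fin n} {K : Multiset (Fin n)}
    (hl : l < i) (h : ∀ x ∈ K, l ≤ x) :
    B.betaOp i (Finsupp.single (l ::ₘ K) 1) = B.betaOp l (B.betaOp i (Finsupp.single K 1))
      + B.betaAction (B.bracket (X i) (X l)) (Finsupp.single K 1) := by
  have h1 : B.betaOp l (Finsupp.single (i ::ₘ K) 1) = Finsupp.single (i ::ₘ l ::ₘ K) 1 := by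
    rw [betaOp_single_of_le, Multiset.cons_swap]
    intro x hx
    rcases Multiset.mem_cons.1 hx with rfl | hx
    · exact hl.le
    · exact h x hx
  rw [betaOp_single_one, Multiset.card_cons, normalForm_cons B _ hl h, betaAction_apply, ← h1]
  simp only [B.betaOp_single_one _ K]
  congr 1
  rw [leibnizExtend_congr (e' := fun J => B.normalForm J.card l J)
    (fun J hJ => hB.normalForm_eq hJ l) (hB.normalForm_spec _ K le_rfl i).1]
  change _ + B.betaOp l _ = _
  rw [map_sub, h1, add_sub_cancel]

/-! ### The commutation relations. -/

variable (B)

/-- The operators `β(x_i)` satisfy the commutation relations on the vector `m`. -/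
def CommutesOn (m : NormalModule k n) : Prop :=
  ∀ i j, B.betaOp i (B.betaOp j m) - B.betaOp j (B.betaOp i m) =
    B.betaAction (B.bracket (X i) (X j)) m

variable {B}

theorem CommutesOn.add {m m' : NormalModule k n} (h : B.CommutesOn m) (h' : B.CommutesOn m') :
    B.CommutesOn (m + m') := fun i j => by
  simp only [map_add, ← h i j, ← h' i j]
  abel

/-- Moving both sides past `a` leaves the terms in which `a` is bracketed twice; these match by the
Jacobi identity for `x_i`, `x_j`, `a`. -/
theorem CommutesOn.smul (a : MvPolynomial (Fin n) k) {m : NormalModule k n} (h : B.CommutesOn m) :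
    B.CommutesOn (a • m) := fun i j => by
  have hj := B.jacobi (X i) (X j) a
  have hb : B.bracket (B.bracket (X i) (X j)) a =
      B.bracket (X i) (B.bracket (X j) a) - B.bracket (X j) (B.bracket (X i) a) := by
    rw [B.bracket_skew _ a, B.bracket_skew (X i) a, map_neg]
    linear_combination -hj
  rw [betaAction_smul, ← h i j, hb]
  simp only [betaOp_smul, map_add, smul_sub, sub_smul]
  abel

/-- Passes from a variable to an arbitrary `a` in the second argument: the extra terms `{x_i, ∂_p
a}` are those produced by `pderiv_bracket`. -/
theorem CommutesOn.betaOp_betaAction {m : NormalModule k n} (h : B.CommutesOn m) (i : Fin n)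
    (a : MvPolynomial (Fin n) k) :
    B.betaOp i (B.betaAction a m) - B.betaAction a (B.betaOp i m) =
      B.betaAction (B.bracket (X i) a) m := by
  simp only [betaAction_apply B a, map_sum, betaOp_smul, ← Finset.sum_sub_distrib]
  rw [betaAction_apply]
  simp only [pderiv_bracket B _ (X i) a, add_smul, Finset.sum_add_distrib, Finset.sum_smul]
  rw [Finset.sum_comm, add_comm, ← Finset.sum_add_distrib]
  refine Finset.sum_congr rfl fun p _ => ?_
  simp only [mul_smul]
  rw [← Finset.smul_sum, ← betaAction_apply, ← h i p, smul_sub]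
  abel

theorem commutesOn_of_mem {c : ℕ} (h : ∀ J : Multiset (Fin n), J.card ≤ c →
    B.CommutesOn (Finsupp.single J 1)) {d : ℕ} {m : NormalModule k n}
    (hm : m ∈ totalDegreeLE k n d c) : B.CommutesOn m := by
  induction hm using Submodule.span_induction with
  | zero => intro i j; simp
  | add x y _ _ hx hy => exact hx.add hy
  | smul t x _ hx =>
    rw [← algebraMap_smul (MvPolynomial (Fin n) k) t x]
    exact hx.smul _
  | mem x hx =>
    obtain ⟨J, s, b, hb, hd, hc, rfl⟩ := hx
    have := (h J hc).smul b
    rwa [Finsupp.smul_single, smul_eq_mul, mul_one] at this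

/-- Strong induction on the `y`-degree. If `j < i` and `j` is at most every index in `J`, the
relation is built into the recursion. Otherwise `y^J = y_l y^K` with `l < j < i`, and the relation
follows from those for `(i, l)` and `(j, l)` together with the Jacobi identity. -/
theorem IsQuadratic.commutesOn_single (hB : B.IsQuadratic) (J : Multiset (Fin n)) :
    B.CommutesOn (Finsupp.single J 1) := by
  induction hd : J.card using Nat.strong_induction_on generalizing J with
  | _ d ih =>
  have base : ∀ (i j : Fin n) (J : Multiset (Fin n)), j < i → (∀ x ∈ J, j ≤ x) →
      B.betaOp i (B.betaOp j (Finsupp.single J 1)) - B.betaOp j (B.betaOp i (Finsupp.single J 1)) =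
        B.betaAction (B.bracket (X i) (X j)) (Finsupp.single J 1) := fun i j J hij h => by
    rw [betaOp_single_of_le B h, hB.betaOp_single_cons hij h, add_sub_cancel_left]
  have key : ∀ i j, j < i →
      B.betaOp i (B.betaOp j (Finsupp.single J 1)) - B.betaOp j (B.betaOp i (Finsupp.single J 1)) =
        B.betaAction (B.bracket (X i) (X j)) (Finsupp.single J 1) := by
    intro i j hij
    rcases forall_le_or_exists_cons j J with h | ⟨l, K, rfl, hl, h⟩
    · exact base i j J hij h
    · rw [Multiset.card_cons] at hd
      have hK : B.CommutesOn (Finsupp.single K 1) := ih K.card (by omega) K rfl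
      have hlow : ∀ r m, m ∈ totalDegreeLE k n r K.card → B.CommutesOn m := fun r m hm =>
        commutesOn_of_mem (fun J hJ => ih J.card (by omega) J rfl) hm
      -- Split `y_j y^K` into its leading monomial and lower terms: `base` covers the first, since
      -- `l` is least, and the induction hypothesis the rest.
      have hstep : ∀ i j : Fin n, l < i → l < j →
          B.betaOp i (B.betaOp l (B.betaOp j (Finsupp.single K 1)))
            - B.betaOp l (B.betaOp i (B.betaOp j (Finsupp.single K 1))) =
          B.betaAction (B.bracket (X i) (X l)) (B.betaOp j (Finsupp.single K 1)) := by
        intro i j hi hj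
        have h1 := hlow _ _ (hB.betaOp_sub_mem j K) i l
        have h2 := base i l (j ::ₘ K) hi (fun x hx => by
          rcases Multiset.mem_cons.1 hx with rfl | hx
          · exact hj.le
          · exact h x hx)
        have h3 := congrArg₂ (· + ·) h1 h2
        simp only [map_sub] at h3
        rw [sub_add_cancel] at h3
        rw [← h3]
        abel
      have hli : l < i := hl.trans hij
      have e1 := hstep i j hli hl
      have e2 := hstep j i hl hli
      have e3 := congrArg (B.betaOp i) (hK j l)
      have e4 := congrArg (B.betaOp j) (hK i l)
      have e5 := hK.betaOp_betaAction i (B.bracket (X j) (X l))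
      have e6 := hK.betaOp_betaAction j (B.bracket (X i) (X l))
      have e7 := hK.betaOp_betaAction l (B.bracket (X i) (X j))
      have e8 := congrArg (B.betaOp l) (hK i j)
      have e9 := congrArg (fun a => B.betaAction a (Finsupp.single K 1))
        (B.jacobi (X i) (X j) (X l))
      rw [B.bracket_skew (X l) (X i), map_neg] at e9
      simp only [map_add, map_neg, LinearMap.add_apply, LinearMap.neg_apply, map_zero,
        LinearMap.zero_apply] at e9
      rw [map_sub] at e3 e4 e8
      rw [← betaOp_single_of_le B h]
      rw [← sub_eq_zero] at e1 e2 e3 e4 e5 e6 e7 e8 ⊢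
      -- In this signed sum the triple products other than those in the goal cancel, and the nested
      -- brackets vanish by `e9`.
      have := congrArg₂ (· + ·) (congrArg₂ (· + ·) (congrArg₂ (· - ·) e1 e2)
        (congrArg₂ (· - ·) e3 e4)) (congrArg₂ (· + ·) (congrArg₂ (· - ·) e5 e6)
          (congrArg₂ (· + ·) (congrArg₂ (· + ·) e7 e8) e9))
      simp only [sub_zero, add_zero] at this
      rw [← this]
      abel
  intro i j
  rcases lt_trichotomy j i with h | rfl | h
  · exact key i j h
  · simp [B.bracket_self]
  · rw [B.bracket_skew, map_neg, LinearMap.neg_apply, ← key j i h, neg_sub]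

end NormalModule

/-! ### The action of `U(P)` and the Poincaré–Birkhoff–Witt theorem in the variables. -/

section NormalOrdering

open MvPolynomial

variable {k : Type u} [Field k] {n : ℕ} {B : PoissonStructure k (MvPolynomial (Fin n) k)}

theorem IsQuadratic.commutesOn (hB : B.IsQuadratic) (m : NormalModule k n) : B.CommutesOn m := by
  induction m using Finsupp.induction_linear with
  | zero => intro i j; simp
  | add x y hx hy => exact hx.add hy
  | single J b =>
    have := (hB.commutesOn_single J).smul b
    rwa [Finsupp.smul_single, smul_eq_mul, mul_one] at this

theorem betaAction_bracket_eq_sum (B : PoissonStructure k (MvPolynomial (Fin n) k))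
    (a b : MvPolynomial (Fin n) k) (m : NormalModule k n) :
    B.betaAction (B.bracket a b) m = ∑ p, (B.bracket a (pderiv p b) • B.betaOp p m +
      pderiv p b • B.betaAction (B.bracket a (X p)) m) := by
  rw [betaAction_apply]
  simp only [pderiv_bracket B _ a b, add_smul, Finset.sum_add_distrib, Finset.sum_smul]
  rw [Finset.sum_comm]
  simp only [mul_smul]
  simp only [← Finset.smul_sum, ← betaAction_apply]

theorem IsQuadratic.betaAction_bracket (hB : B.IsQuadratic) (a b : MvPolynomial (Fin n) k)
    (m : NormalModule k n) :
    B.betaAction (B.bracket a b) m =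
      B.betaAction a (B.betaAction b m) - B.betaAction b (B.betaAction a m) := by
  rw [B.bracket_skew a b, map_neg, LinearMap.neg_apply, betaAction_bracket_eq_sum,
    betaAction_apply B a, betaAction_apply B a, map_sum, ← Finset.sum_sub_distrib,
    ← Finset.sum_neg_distrib]
  refine Finset.sum_congr rfl fun p _ => ?_
  rw [betaAction_smul, B.bracket_skew b (X p), map_neg, LinearMap.neg_apply,
    ← (hB.commutesOn m).betaOp_betaAction, smul_neg, smul_sub]
  abel

theorem IsQuadratic.isEnvelopingTriple_action (hB : B.IsQuadratic) :
    B.IsEnvelopingTriple (U := Module.End k (NormalModule k n))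
      (Algebra.lsmul k k (NormalModule k n) :
        MvPolynomial (Fin n) k →ₐ[k] Module.End k (NormalModule k n)) B.betaAction where
  beta_bracket a b := LinearMap.ext fun m => hB.betaAction_bracket a b m
  alpha_bracket a b := LinearMap.ext fun m => by
    change B.bracket a b • m = B.betaAction a (b • m) - b • B.betaAction a m
    rw [betaAction_smul, add_sub_cancel_left]
  beta_mul a b := LinearMap.ext fun m => by
    change B.betaAction (a * b) m = a • B.betaAction b m + b • B.betaAction a m
    simp only [betaAction_apply, Finset.smul_sum, ← Finset.sum_add_distrib]
    refine Finset.sum_congr rfl fun p _ => ?_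
    rw [pderiv_mul, add_smul, mul_smul, mul_comm, mul_smul, smul_comm, add_comm,
      smul_comm (pderiv p b)]

/-- The action of `U(P)` on the normally ordered products. -/
noncomputable def IsQuadratic.action (hB : B.IsQuadratic) :
    B.Enveloping →ₐ[k] Module.End k (NormalModule k n) :=
  B.lift _ _ hB.isEnvelopingTriple_action

theorem IsQuadratic.action_alpha (hB : B.IsQuadratic) (a : MvPolynomial (Fin n) k)
    (m : NormalModule k n) : hB.action (B.alpha a) m = a • m :=
  LinearMap.congr_fun (B.lift_alpha _ _ hB.isEnvelopingTriple_action a) m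

theorem IsQuadratic.action_beta (hB : B.IsQuadratic) (a : MvPolynomial (Fin n) k)
    (m : NormalModule k n) : hB.action (B.beta a) m = B.betaAction a m :=
  LinearMap.congr_fun (B.lift_beta _ _ hB.isEnvelopingTriple_action a) m

theorem beta_one {P : Type v} [CommRing P] [Algebra k P] (B : PoissonStructure k P) :
    B.beta 1 = 0 := by
  have h := B.isEnvelopingTriple.beta_mul 1 1
  rw [mul_one, map_one B.alpha, one_mul] at h
  exact left_eq_add.1 h

/-- `β` obeys the product rule of a differential, so this is `da = ∑ ∂_p a dx_p`. -/
theorem beta_eq_sum (B : PoissonStructure k (MvPolynomial (Fin n) k))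
    (a : MvPolynomial (Fin n) k) : B.beta a = ∑ p, B.alpha (pderiv p a) * B.beta (X p) := by
  induction a using MvPolynomial.induction_on with
  | C r =>
    rw [← mul_one (C r), ← smul_eq_C_mul, map_smul, beta_one]
    simp [smul_eq_C_mul]
  | add a b ha hb =>
    rw [map_add, ha, hb, ← Finset.sum_add_distrib]
    exact Finset.sum_congr rfl fun p _ => by rw [map_add, map_add, add_mul]
  | mul_X a i ha =>
    rw [B.isEnvelopingTriple.beta_mul]
    simp only [pderiv_mul, map_add, map_mul, add_mul, Finset.sum_add_distrib]
    rw [add_comm, ha, Finset.mul_sum]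
    congr 1
    · refine Finset.sum_congr rfl fun p _ => ?_
      rw [← mul_assoc, ← map_mul, ← map_mul, mul_comm]
    · rw [Finset.sum_eq_single i]
      · simp
      · intro p _ hp
        simp [pderiv_X_of_ne hp.symm]
      · simp

/-- The product in `U(P)` of the `β(x_i)`, `i ∈ J`, in increasing order of `i`. -/
noncomputable def betaWord (B : PoissonStructure k (MvPolynomial (Fin n) k))
    (v : Fin n → MvPolynomial (Fin n) k) (J : Multiset (Fin n)) : B.Enveloping :=
  ((J.sort (· ≤ ·)).map fun i => B.beta (v i)).prod

theorem betaWord_cons (B : PoissonStructure k (MvPolynomial (Fin n) k))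
    (v : Fin n → MvPolynomial (Fin n) k) {l : Fin n} {J : Multiset (Fin n)}
    (h : ∀ x ∈ J, l ≤ x) : B.betaWord v (l ::ₘ J) = B.beta (v l) * B.betaWord v J := by
  rw [betaWord, Multiset.sort_cons _ _ _ h, List.map_cons, List.prod_cons, betaWord]

theorem betaWord_zero (B : PoissonStructure k (MvPolynomial (Fin n) k))
    (v : Fin n → MvPolynomial (Fin n) k) : B.betaWord v 0 = 1 := by
  simp [betaWord]

/-- The evaluation `a y^J ↦ α(a) β(x)^J` of normally ordered products in `U(P)`. -/
noncomputable def normalOrder (B : PoissonStructure k (MvPolynomial (Fin n) k)) :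
    NormalModule k n →ₗ[k] B.Enveloping :=
  Finsupp.lsum k fun J => LinearMap.mulRight k (B.betaWord X J) ∘ₗ B.alpha.toLinearMap

theorem normalOrder_single (B : PoissonStructure k (MvPolynomial (Fin n) k))
    (J : Multiset (Fin n)) (a : MvPolynomial (Fin n) k) :
    B.normalOrder (Finsupp.single J a) = B.alpha a * B.betaWord X J := by
  simp [normalOrder]

theorem normalOrder_smul (B : PoissonStructure k (MvPolynomial (Fin n) k))
    (a : MvPolynomial (Fin n) k) (m : NormalModule k n) :
    B.normalOrder (a • m) = B.alpha a * B.normalOrder m := by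
  induction m using Finsupp.induction_linear with
  | zero => simp
  | add x y hx hy => rw [smul_add, map_add, hx, hy, map_add, mul_add]
  | single J b =>
    rw [Finsupp.smul_single, normalOrder_single, normalOrder_single, smul_eq_mul, map_mul,
      mul_assoc]

theorem normalOrder_betaOp_smul (B : PoissonStructure k (MvPolynomial (Fin n) k)) {i : Fin n}
    {m : NormalModule k n} (h : B.normalOrder (B.betaOp i m) = B.beta (X i) * B.normalOrder m)
    (a : MvPolynomial (Fin n) k) :
    B.normalOrder (B.betaOp i (a • m)) = B.beta (X i) * B.normalOrder (a • m) := by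
  rw [betaOp_smul, map_add, normalOrder_smul, normalOrder_smul, normalOrder_smul, h,
    B.isEnvelopingTriple.alpha_bracket, sub_mul, mul_assoc, mul_assoc]
  abel

theorem normalOrder_betaAction_of_forall (B : PoissonStructure k (MvPolynomial (Fin n) k))
    {m : NormalModule k n}
    (h : ∀ i, B.normalOrder (B.betaOp i m) = B.beta (X i) * B.normalOrder m)
    (a : MvPolynomial (Fin n) k) :
    B.normalOrder (B.betaAction a m) = B.beta a * B.normalOrder m := by
  rw [betaAction_apply, map_sum, beta_eq_sum, Finset.sum_mul]
  exact Finset.sum_congr rfl fun p _ => by rw [normalOrder_smul, h, mul_assoc]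

/-- The recursion defining `betaOp` uses only identities that hold in `U(P)`, so evaluation turns it
into left multiplication. This yields the spanning half of the PBW theorem. -/
theorem IsQuadratic.normalOrder_betaOp_single (hB : B.IsQuadratic) (J : Multiset (Fin n)) :
    ∀ i, B.normalOrder (B.betaOp i (Finsupp.single J 1)) =
      B.beta (X i) * B.normalOrder (Finsupp.single J 1) := by
  induction hd : J.card using Nat.strong_induction_on generalizing J with
  | _ d ih =>
  intro i
  have base : ∀ (i : Fin n) (J : Multiset (Fin n)), (∀ x ∈ J, i ≤ x) →
      B.normalOrder (B.betaOp i (Finsupp.single J 1)) =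
        B.beta (X i) * B.normalOrder (Finsupp.single J 1) := fun i J h => by
    rw [betaOp_single_of_le B h, normalOrder_single, normalOrder_single, map_one, one_mul, one_mul,
      betaWord_cons B _ h]
  rcases forall_le_or_exists_cons i J with h | ⟨l, K, rfl, hl, h⟩
  · exact base i J h
  · rw [Multiset.card_cons] at hd
    have hlow : ∀ r m, m ∈ totalDegreeLE k n r K.card →
        B.normalOrder (B.betaOp l m) = B.beta (X l) * B.normalOrder m := by
      intro r m hm
      induction hm using Submodule.span_induction with
      | zero => simp
      | add x y _ _ hx hy => rw [map_add, map_add, hx, hy, map_add, mul_add]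
      | smul t x _ hx => rw [map_smul, map_smul, hx, map_smul, mul_smul_comm]
      | mem x hx =>
        obtain ⟨L, s, b, hb, hs, hc, rfl⟩ := hx
        have := B.normalOrder_betaOp_smul (ih L.card (by omega) L rfl l) b
        rwa [Finsupp.smul_single, smul_eq_mul, mul_one] at this
    have hK := ih K.card (by omega) K rfl
    have h1 := hlow _ _ (hB.betaOp_sub_mem i K)
    have h2 := base l (i ::ₘ K) (fun x hx => by
      rcases Multiset.mem_cons.1 hx with rfl | hx
      · exact hl.le
      · exact h x hx)
    have h3 := congrArg₂ (· + ·) h1 h2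
    simp only [map_sub, mul_sub] at h3
    rw [sub_add_cancel, sub_add_cancel] at h3
    rw [hB.betaOp_single_cons hl h, map_add, h3, hK, normalOrder_betaAction_of_forall B hK,
      B.isEnvelopingTriple.beta_bracket, ← betaOp_single_of_le B h, base l K h]
    simp only [sub_mul, mul_assoc]
    abel

theorem IsQuadratic.normalOrder_betaOp (hB : B.IsQuadratic) (i : Fin n) (m : NormalModule k n) :
    B.normalOrder (B.betaOp i m) = B.beta (X i) * B.normalOrder m := by
  induction m using Finsupp.induction_linear with
  | zero => simp
  | add x y hx hy => rw [map_add, map_add, hx, hy, map_add, mul_add]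
  | single J b =>
    have := B.normalOrder_betaOp_smul (hB.normalOrder_betaOp_single J i) b
    rwa [Finsupp.smul_single, smul_eq_mul, mul_one] at this

theorem IsQuadratic.action_normalOrder (hB : B.IsQuadratic) (m : NormalModule k n) :
    hB.action (B.normalOrder m) (Finsupp.single 0 1) = m := by
  induction m using Finsupp.induction_linear with
  | zero => simp
  | add x y hx hy => rw [map_add, map_add, LinearMap.add_apply, hx, hy]
  | single J b =>
    -- In a sorted word each letter acts on a monomial with no smaller index, so no reordering
    -- occurs.
    have hw : hB.action (B.betaWord X J) (Finsupp.single 0 1) = Finsupp.single J 1 := by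
      have hs := J.pairwise_sort (· ≤ ·)
      have he := J.sort_eq (· ≤ ·)
      rw [← he]
      clear he
      generalize J.sort (· ≤ ·) = L at hs
      induction L with
      | nil => simp [betaWord_zero]
      | cons l L ih =>
        rw [List.pairwise_cons] at hs
        have hl : ∀ x ∈ (L : Multiset (Fin n)), l ≤ x := fun x hx => hs.1 x hx
        rw [← Multiset.cons_coe, betaWord_cons B _ hl, map_mul, Module.End.mul_apply, ih hs.2,
          hB.action_beta, betaAction_X, betaOp_single_of_le B hl]
    rw [normalOrder_single, map_mul, Module.End.mul_apply, hw, hB.action_alpha,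
      Finsupp.smul_single, smul_eq_mul, mul_one]

theorem IsQuadratic.normalOrder_injective (hB : B.IsQuadratic) :
    Function.Injective B.normalOrder :=
  Function.LeftInverse.injective (g := fun u => hB.action u (Finsupp.single 0 1))
    hB.action_normalOrder

/-- The space `V` spanned by the generators of `U(P)`. -/
noncomputable abbrev generatorSpan (B : PoissonStructure k (MvPolynomial (Fin n) k)) :
    Submodule k B.Enveloping :=
  Submodule.span k (Set.range (fun i : Fin n => B.alpha (X i)) ∪
    Set.range (fun i : Fin n => B.beta (X i)))

theorem alpha_mem_envGrading (B : PoissonStructure k (MvPolynomial (Fin n) k)) {r : ℕ}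
    {a : MvPolynomial (Fin n) k} (ha : a ∈ polyGrading k n r) : B.alpha a ∈ B.envGrading r := by
  have h : (polyGrading k n 1).map B.alpha.toLinearMap ≤ B.generatorSpan := by
    rw [polyGrading, homogeneousSubmodule_one_eq_span_X, Submodule.map_span_le]
    rintro _ ⟨i, rfl⟩
    exact Submodule.subset_span (Or.inl ⟨i, rfl⟩)
  have hp := pow_le_pow_left' h r
  rw [← Submodule.map_pow, polyGrading, homogeneousSubmodule_one_pow] at hp
  exact hp (Submodule.mem_map_of_mem ha)

theorem betaWord_mem_envGrading (B : PoissonStructure k (MvPolynomial (Fin n) k))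
    (J : Multiset (Fin n)) : B.betaWord X J ∈ B.envGrading J.card := by
  rw [← Multiset.length_sort (r := (· ≤ ·)), betaWord]
  induction J.sort (· ≤ ·) with
  | nil => exact Submodule.one_le.1 (pow_zero B.generatorSpan).ge
  | cons l L ih =>
    rw [List.map_cons, List.prod_cons, List.length_cons, envGrading, pow_succ']
    exact Submodule.mul_mem_mul (Submodule.subset_span (Or.inr ⟨l, rfl⟩)) ih

/-- The image is stable under left multiplication by generators, with the degree rising by one. The
bound on the `y`-degree is automatic here, as it equals the total degree. -/
theorem IsQuadratic.envGrading_eq_map (hB : B.IsQuadratic) (d : ℕ) :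
    B.envGrading d = (totalDegreeLE k n d d).map B.normalOrder := by
  apply le_antisymm
  · induction d with
    | zero =>
      rw [envGrading, pow_zero, Submodule.one_le]
      refine ⟨Finsupp.single 0 1, single_mem_totalDegreeLE one_mem_polyGrading rfl le_rfl, ?_⟩
      rw [normalOrder_single, betaWord_zero, map_one, one_mul]
    | succ d ih =>
      rw [envGrading, pow_succ', Submodule.mul_le]
      intro a ha b hb
      obtain ⟨m, hm, rfl⟩ := ih hb
      induction ha using Submodule.span_induction with
      | zero => rw [zero_mul]; exact zero_mem _
      | add x y _ _ hx hy => rw [add_mul]; exact add_mem hx hy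
      | smul t x _ hx => rw [smul_mul_assoc]; exact Submodule.smul_mem _ _ hx
      | mem x hx =>
        rcases hx with ⟨i, rfl⟩ | ⟨i, rfl⟩
        · refine ⟨X i • m, totalDegreeLE_mono (Nat.le_succ d)
            (smul_mem_totalDegreeLE (isHomogeneous_X k i) hm), ?_⟩
          rw [normalOrder_smul]
        · exact ⟨B.betaOp i m, hB.betaOp_mem i hm, hB.normalOrder_betaOp i m⟩
  · rw [totalDegreeLE, Submodule.map_span_le]
    rintro _ ⟨J, r, a, ha, rfl, _, rfl⟩
    rw [normalOrder_single, envGrading, pow_add]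
    exact Submodule.mul_mem_mul (B.alpha_mem_envGrading ha) (B.betaWord_mem_envGrading J)

theorem polyGrading_eq_span (d : ℕ) : polyGrading k n d =
    Submodule.span k ((fun I => monomial I (1 : k)) ''
      (Finset.finsuppAntidiag (Finset.univ : Finset (Fin n)) d : Set (Fin n →₀ ℕ))) := by
  apply le_antisymm
  · intro a ha
    rw [← a.support_sum_monomial_coeff]
    refine sum_mem fun I hI => ?_
    have hd : I.degree = d := by
      by_contra h
      exact mem_support_iff.1 hI (IsHomogeneous.coeff_eq_zero ha h)
    rw [← mul_one (coeff I a), ← smul_eq_mul, ← smul_monomial]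
    refine Submodule.smul_mem _ _ (Submodule.subset_span ⟨I, ?_, rfl⟩)
    rw [Finsupp.degree_eq_sum] at hd
    simpa using hd
  · rw [Submodule.span_le]
    rintro _ ⟨I, hI, rfl⟩
    refine isHomogeneous_monomial _ ?_
    rw [Finsupp.degree_eq_sum]
    simpa using hI

/-- The Poincaré–Birkhoff–Witt monomials of `U(P)`. -/
noncomputable def pbwMonomial (B : PoissonStructure k (MvPolynomial (Fin n) k))
    (ψ : MvPolynomial (Fin n) k →ₐ[k] MvPolynomial (Fin n) k) (I : Fin n ⊕ Fin n →₀ ℕ) :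
    B.Enveloping :=
  B.alpha (ψ (monomial (Finsupp.sumFinsuppEquivProdFinsupp I).1 1)) *
    B.betaWord (fun i => ψ (X i)) (Finsupp.toMultiset (Finsupp.sumFinsuppEquivProdFinsupp I).2)

theorem normalOrder_single_monomial (B : PoissonStructure k (MvPolynomial (Fin n) k))
    (I : Fin n ⊕ Fin n →₀ ℕ) :
    B.normalOrder (Finsupp.single (Finsupp.toMultiset (Finsupp.sumFinsuppEquivProdFinsupp I).2)
      (monomial (Finsupp.sumFinsuppEquivProdFinsupp I).1 1)) = B.pbwMonomial (AlgHom.id k _) I := by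
  rw [normalOrder_single]
  rfl

theorem IsQuadratic.linearIndependent_pbwMonomial (hB : B.IsQuadratic) :
    LinearIndependent k (B.pbwMonomial (AlgHom.id k _)) := by
  have h1 := Finsupp.linearIndependent_single
    (fun (_ : Multiset (Fin n)) (I : Fin n →₀ ℕ) => monomial I (1 : k))
    (fun _ => by
      have := (basisMonomials (Fin n) k).linearIndependent
      rwa [coe_basisMonomials] at this)
  have h2 := h1.comp (fun I : Fin n ⊕ Fin n →₀ ℕ =>
    (⟨Finsupp.toMultiset (Finsupp.sumFinsuppEquivProdFinsupp I).2,
      (Finsupp.sumFinsuppEquivProdFinsupp I).1⟩ : Σ _ : Multiset (Fin n), Fin n →₀ ℕ)) (by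
      intro I I' h
      simp only [Sigma.mk.injEq, heq_eq_eq] at h
      exact Finsupp.sumFinsuppEquivProdFinsupp.injective
        (Prod.ext h.2 (Multiset.toFinsupp.symm.injective h.1)))
  have h3 := h2.map' B.normalOrder (LinearMap.ker_eq_bot.2 hB.normalOrder_injective)
  exact (funext B.normalOrder_single_monomial :
    (fun I => B.normalOrder (Finsupp.single _ _)) = _) ▸ h3

theorem IsQuadratic.envGrading_eq_span (hB : B.IsQuadratic) (d : ℕ) : B.envGrading d =
    Submodule.span k (B.pbwMonomial (AlgHom.id k _) ''
      (Finset.finsuppAntidiag (Finset.univ : Finset (Fin n ⊕ Fin n)) d :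
        Set (Fin n ⊕ Fin n →₀ ℕ))) := by
  rw [hB.envGrading_eq_map]
  apply le_antisymm
  · rw [totalDegreeLE, Submodule.map_span_le]
    rintro _ ⟨J, r, a, ha, hd, _, rfl⟩
    rw [polyGrading_eq_span] at ha
    induction ha using Submodule.span_induction with
    | zero => simp
    | add x y _ _ hx hy => rw [Finsupp.single_add, map_add]; exact add_mem hx hy
    | smul t x _ hx => rw [← Finsupp.smul_single, map_smul]; exact Submodule.smul_mem _ _ hx
    | mem x hx =>
      obtain ⟨I, hI, rfl⟩ := hx
      refine Submodule.subset_span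
        ⟨Finsupp.sumFinsuppEquivProdFinsupp.symm (I, Multiset.toFinsupp J), ?_, ?_⟩
      · have hJ : ∑ i, (Multiset.toFinsupp J) i = J.card := by
          rw [← Finsupp.degree_eq_sum]
          conv_rhs => rw [← Multiset.toFinsupp_toMultiset J, Finsupp.card_toMultiset]
          rfl
        simp only [Finset.mem_coe, Finset.mem_finsuppAntidiag, Finset.subset_univ, and_true] at hI ⊢
        rw [Fintype.sum_sum_type]
        simp only [Finsupp.sumFinsuppEquivProdFinsupp_symm_inl,
          Finsupp.sumFinsuppEquivProdFinsupp_symm_inr]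
        rw [hJ, hI, hd]
      · rw [← normalOrder_single_monomial, Equiv.apply_symm_apply]
        simp
  · rw [Submodule.span_le]
    rintro _ ⟨I, hI, rfl⟩
    rw [← normalOrder_single_monomial]
    have hI' : ∑ i, I (Sum.inl i) + ∑ i, I (Sum.inr i) = d := by
      simpa [Fintype.sum_sum_type] using hI
    have hJ : (Finsupp.toMultiset (Finsupp.sumFinsuppEquivProdFinsupp I).2).card =
        ∑ i, I (Sum.inr i) := by
      rw [Finsupp.card_toMultiset, Finsupp.sum_fintype _ _ (fun _ => rfl)]
      rfl
    refine Submodule.mem_map_of_mem (single_mem_totalDegreeLE (r := ∑ i, I (Sum.inl i))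
      (isHomogeneous_monomial _ ?_) ?_ ?_)
    · rw [Finsupp.degree_eq_sum]
      rfl
    · rw [hJ, hI']
    · omega

end NormalOrdering

/-! ### Transport of the bracket and of `U(P)` along an algebra automorphism. -/

section Transport

variable {k : Type u} {P : Type v} [CommRing k] [CommRing P] [Algebra k P]

/-- The Poisson structure transported along an algebra automorphism. -/
noncomputable def comap (B : PoissonStructure k P) (ψ : P ≃ₐ[k] P) : PoissonStructure k P where
  bracket := (B.bracket.compl₁₂ ψ.toLinearMap ψ.toLinearMap).compr₂ ψ.symm.toLinearMap
  bracket_self a := by simp [B.bracket_self]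
  jacobi a b c := by simp [← map_add, B.jacobi]
  leibniz a b c := by simp [B.leibniz]

theorem comap_bracket (B : PoissonStructure k P) (ψ : P ≃ₐ[k] P) (a b : P) :
    (B.comap ψ).bracket a b = ψ.symm (B.bracket (ψ a) (ψ b)) := by
  simp [comap]

theorem isEnvelopingTriple_comap (B : PoissonStructure k P) (ψ : P ≃ₐ[k] P) :
    (B.comap ψ).IsEnvelopingTriple (B.alpha.comp (ψ : P →ₐ[k] P))
      (B.beta.comp ψ.toLinearMap) where
  beta_bracket a b := by simp [comap_bracket, B.isEnvelopingTriple.beta_bracket]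
  alpha_bracket a b := by simp [comap_bracket, B.isEnvelopingTriple.alpha_bracket]
  beta_mul a b := by simp [B.isEnvelopingTriple.beta_mul]

theorem isEnvelopingTriple_comap_symm (B : PoissonStructure k P) (ψ : P ≃ₐ[k] P) :
    B.IsEnvelopingTriple ((B.comap ψ).alpha.comp (ψ.symm : P →ₐ[k] P))
      ((B.comap ψ).beta.comp ψ.symm.toLinearMap) where
  beta_bracket a b := by
    have h := (B.comap ψ).isEnvelopingTriple.beta_bracket (ψ.symm a) (ψ.symm b)
    simpa [comap_bracket] using h
  alpha_bracket a b := by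
    have h := (B.comap ψ).isEnvelopingTriple.alpha_bracket (ψ.symm a) (ψ.symm b)
    simpa [comap_bracket] using h
  beta_mul a b := by simp [(B.comap ψ).isEnvelopingTriple.beta_mul]

/-- Transport of Poisson enveloping algebras along an algebra automorphism of `P`. -/
noncomputable def comapEquiv (B : PoissonStructure k P) (ψ : P ≃ₐ[k] P) :
    (B.comap ψ).Enveloping ≃ₐ[k] B.Enveloping :=
  AlgEquiv.ofAlgHom ((B.comap ψ).lift _ _ (B.isEnvelopingTriple_comap ψ))
    (B.lift _ _ (B.isEnvelopingTriple_comap_symm ψ))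
    (B.hom_ext (fun a => by simp [lift_alpha]) (fun a => by simp [lift_beta]))
    ((B.comap ψ).hom_ext (fun a => by simp [lift_alpha]) (fun a => by simp [lift_beta]))

theorem comapEquiv_alpha (B : PoissonStructure k P) (ψ : P ≃ₐ[k] P) (a : P) :
    B.comapEquiv ψ ((B.comap ψ).alpha a) = B.alpha (ψ a) :=
  (B.comap ψ).lift_alpha _ _ (B.isEnvelopingTriple_comap ψ) a

theorem comapEquiv_beta (B : PoissonStructure k P) (ψ : P ≃ₐ[k] P) (a : P) :
    B.comapEquiv ψ ((B.comap ψ).beta a) = B.beta (ψ a) :=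
  (B.comap ψ).lift_beta _ _ (B.isEnvelopingTriple_comap ψ) a

end Transport

/-! ### The Poincaré–Birkhoff–Witt theorem in an arbitrary basis of the linear forms. -/

section LinearChange

open MvPolynomial

variable {k : Type u} [Field k] {n : ℕ} {B : PoissonStructure k (MvPolynomial (Fin n) k)}
  {ψ : MvPolynomial (Fin n) k ≃ₐ[k] MvPolynomial (Fin n) k}

theorem IsQuadratic.comap (hB : B.IsQuadratic)
    (hψ : ∀ d, (polyGrading k n d).map ψ.toLinearMap = polyGrading k n d) :
    (B.comap ψ).IsQuadratic := by
  intro f hf g hg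
  have hmem : ∀ a ∈ polyGrading k n 1, ψ a ∈ polyGrading k n 1 := fun a ha => by
    rw [← hψ 1]
    exact Submodule.mem_map_of_mem ha
  have h := hB _ (hmem f hf) _ (hmem g hg)
  rw [← hψ 2] at h
  obtain ⟨c, hc, hc'⟩ := h
  rw [comap_bracket, ← hc']
  simpa using hc

theorem generatorSpan_eq (B : PoissonStructure k (MvPolynomial (Fin n) k)) :
    B.generatorSpan = (polyGrading k n 1).map B.alpha.toLinearMap ⊔
      (polyGrading k n 1).map B.beta := by
  rw [generatorSpan, Submodule.span_union, polyGrading, homogeneousSubmodule_one_eq_span_X,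
    Submodule.map_span, Submodule.map_span, ← Set.range_comp, ← Set.range_comp]
  rfl

/-- The generating subspace is `α(P_1) + β(P_1)`, which does not depend on the basis of `P_1`. -/
theorem map_comapEquiv_envGrading (B : PoissonStructure k (MvPolynomial (Fin n) k))
    (hψ : (polyGrading k n 1).map ψ.toLinearMap = polyGrading k n 1) (d : ℕ) :
    ((B.comap ψ).envGrading d).map
      ((B.comapEquiv ψ : (B.comap ψ).Enveloping →ₐ[k] B.Enveloping).toLinearMap) =
      B.envGrading d := by
  rw [envGrading, Submodule.map_pow]
  change _ = B.generatorSpan ^ d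
  congr 1
  change (B.comap ψ).generatorSpan.map _ = _
  rw [generatorSpan_eq, generatorSpan_eq, Submodule.map_sup]
  conv_rhs => rw [← hψ]
  rw [← Submodule.map_comp, ← Submodule.map_comp, ← Submodule.map_comp, ← Submodule.map_comp]
  congr 2
  · exact LinearMap.ext fun a => B.comapEquiv_alpha ψ a
  · exact LinearMap.ext fun a => B.comapEquiv_beta ψ a

theorem comapEquiv_pbwMonomial (B : PoissonStructure k (MvPolynomial (Fin n) k))
    (I : Fin n ⊕ Fin n →₀ ℕ) :
    B.comapEquiv ψ ((B.comap ψ).pbwMonomial (AlgHom.id k _) I) =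
      B.pbwMonomial (ψ : MvPolynomial (Fin n) k →ₐ[k] MvPolynomial (Fin n) k) I := by
  rw [pbwMonomial, pbwMonomial, map_mul, comapEquiv_alpha, betaWord, betaWord, map_list_prod,
    List.map_map]
  congr 3
  funext i
  exact B.comapEquiv_beta ψ _

/-- The Poincaré–Birkhoff–Witt theorem for `U(P)`: linear independence. -/
theorem IsQuadratic.linearIndependent_pbwMonomial_of_linearChange (hB : B.IsQuadratic)
    (hψ : ∀ d, (polyGrading k n d).map ψ.toLinearMap = polyGrading k n d) :
    LinearIndependent k
      (B.pbwMonomial (ψ : MvPolynomial (Fin n) k →ₐ[k] MvPolynomial (Fin n) k)) := by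
  have h := (hB.comap hψ).linearIndependent_pbwMonomial.map'
    ((B.comapEquiv ψ : (B.comap ψ).Enveloping →ₐ[k] B.Enveloping).toLinearMap)
    (LinearMap.ker_eq_bot.2 (B.comapEquiv ψ).injective)
  exact (funext B.comapEquiv_pbwMonomial :
    (fun I => B.comapEquiv ψ ((B.comap ψ).pbwMonomial (AlgHom.id k _) I)) = _) ▸ h

/-- The Poincaré–Birkhoff–Witt theorem for `U(P)`: generation. -/
theorem IsQuadratic.envGrading_eq_span_of_linearChange (hB : B.IsQuadratic)
    (hψ : ∀ d, (polyGrading k n d).map ψ.toLinearMap = polyGrading k n d) (d : ℕ) :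
    B.envGrading d = Submodule.span k
      (B.pbwMonomial (ψ : MvPolynomial (Fin n) k →ₐ[k] MvPolynomial (Fin n) k) ''
      (Finset.finsuppAntidiag (Finset.univ : Finset (Fin n ⊕ Fin n)) d :
        Set (Fin n ⊕ Fin n →₀ ℕ))) := by
  rw [← B.map_comapEquiv_envGrading (hψ 1), (hB.comap hψ).envGrading_eq_span, Submodule.map_span,
    ← Set.image_comp]
  congr 2
  exact funext B.comapEquiv_pbwMonomial

theorem polyGrading_eq_span_of_linearChange
    (hψ : ∀ d, (polyGrading k n d).map ψ.toLinearMap = polyGrading k n d) (d : ℕ) :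
    polyGrading k n d = Submodule.span k ((fun I => ψ (monomial I (1 : k))) ''
      (Finset.finsuppAntidiag (Finset.univ : Finset (Fin n)) d : Set (Fin n →₀ ℕ))) := by
  rw [← hψ d, polyGrading_eq_span, Submodule.map_span, ← Set.image_comp]
  rfl

theorem linearIndependent_monomial_of_linearChange :
    LinearIndependent k (fun I : Fin n →₀ ℕ => ψ (monomial I (1 : k))) := by
  have h := (basisMonomials (Fin n) k).linearIndependent
  rw [coe_basisMonomials] at h
  exact h.map' ψ.toLinearMap (LinearMap.ker_eq_bot.2 ψ.injective)

theorem map_monomial_of_eigen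
    {φ : MvPolynomial (Fin n) k →ₐ[k] MvPolynomial (Fin n) k} {w : Fin n → k}
    (hw : ∀ i, φ (ψ (X i)) = w i • ψ (X i)) (I : Fin n →₀ ℕ) :
    φ (ψ (monomial I 1)) = (∏ i, w i ^ I i) • ψ (monomial I 1) := by
  rw [monomial_eq, C_1, one_mul, Finsupp.prod_fintype _ _ (fun _ => pow_zero _)]
  simp only [map_prod, map_pow, hw, smul_pow]
  rw [Finset.prod_smul]

theorem inducedAut_pbwMonomial {φ : MvPolynomial (Fin n) k ≃ₐ[k] MvPolynomial (Fin n) k}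
    (hφ : B.IsPoissonAut φ) {w : Fin n → k}
    (hw : ∀ i, φ (ψ (X i)) = w i • ψ (X i)) (I : Fin n ⊕ Fin n →₀ ℕ) :
    B.inducedAut φ hφ (B.pbwMonomial (ψ : MvPolynomial (Fin n) k →ₐ[k] MvPolynomial (Fin n) k) I) =
      (∏ i, Sum.elim w w i ^ I i) •
        B.pbwMonomial (ψ : MvPolynomial (Fin n) k →ₐ[k] MvPolynomial (Fin n) k) I := by
  have h1 : ∀ L : List (Fin n), B.inducedAut φ hφ (L.map fun i => B.beta (ψ (X i))).prod =
      (L.map w).prod • (L.map fun i => B.beta (ψ (X i))).prod := by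
    intro L
    induction L with
    | nil => simp
    | cons l L ih =>
      simp only [List.map_cons, List.prod_cons]
      rw [map_mul, ih, inducedAut_beta, hw, map_smul, smul_mul_smul_comm]
  have h2 : ∀ J : Fin n →₀ ℕ,
      (((Finsupp.toMultiset J).sort (· ≤ ·)).map w).prod = ∏ i, w i ^ J i := by
    intro J
    rw [← Multiset.prod_coe, ← Multiset.map_coe, Multiset.sort_eq, Finset.prod_multiset_map_count]
    simp only [Finsupp.count_toMultiset]
    refine Finset.prod_subset (Finset.subset_univ _) fun i _ hi => ?_
    rw [Finsupp.toFinset_toMultiset, Finsupp.notMem_support_iff] at hi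
    rw [hi, pow_zero]
  have h3 := map_monomial_of_eigen (φ := (φ : MvPolynomial (Fin n) k →ₐ[k] _)) hw
    (Finsupp.sumFinsuppEquivProdFinsupp I).1
  rw [pbwMonomial, betaWord, map_mul]
  simp only [AlgEquiv.coe_toAlgHom] at h3 ⊢
  rw [h1, h2, inducedAut_alpha, h3, map_smul, smul_mul_smul_comm, Fintype.prod_sum_type]
  rfl

end LinearChange

/-! ### Trace series of diagonal maps. -/

section TraceSeries

variable {k : Type u} [Field k]

theorem trace_restrict_eq_sum {A : Type v} [AddCommGroup A] [Module k A] {σ : Type w}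
    {u : σ → A} (hu : LinearIndependent k u) (T : Finset σ) {W : Submodule k A}
    (hW : W = Submodule.span k (u '' (T : Set σ))) {f : A →ₗ[k] A} (hf : ∀ a ∈ W, f a ∈ W)
    {μ : σ → k} (hμ : ∀ i, f (u i) = μ i • u i) :
    LinearMap.trace k W (f.restrict hf) = ∑ i ∈ T, μ i := by
  classical
  have hmem : ∀ i : T, u i ∈ W := fun i => by
    rw [hW]
    exact Submodule.subset_span ⟨i, i.2, rfl⟩
  let v : T → W := fun i => ⟨u i, hmem i⟩
  have hli : LinearIndependent k v :=
    LinearIndependent.of_comp W.subtype (hu.comp (fun i : T => (i : σ)) Subtype.val_injective)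
  have hsp : ⊤ ≤ Submodule.span k (Set.range v) := by
    rw [← Submodule.map_le_map_iff_of_injective W.injective_subtype, Submodule.map_span,
      Submodule.map_top, Submodule.range_subtype, ← Set.range_comp]
    refine hW.le.trans (Submodule.span_mono ?_)
    rintro _ ⟨i, hi, rfl⟩
    exact ⟨⟨i, hi⟩, rfl⟩
  let b : Module.Basis T k W := Module.Basis.mk hli hsp
  rw [LinearMap.trace_eq_matrix_trace k b, Matrix.trace, ← Finset.sum_coe_sort T μ]
  refine Finset.sum_congr rfl fun i _ => ?_
  have hv : f.restrict hf (b i) = μ i • b i := by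
    rw [Module.Basis.mk_apply]
    exact Subtype.ext (hμ i)
  rw [Matrix.diag_apply, LinearMap.toMatrix_apply, hv]
  simp

theorem mk_pow_mul_one_sub (a : k) :
    PowerSeries.mk (fun j => a ^ j) * (1 - PowerSeries.C a * PowerSeries.X) = 1 := by
  have h := congrArg (PowerSeries.rescale a) (PowerSeries.mk_one_mul_one_sub_eq_one k)
  rw [map_mul, map_sub, map_one, PowerSeries.rescale_X, PowerSeries.rescale_mk] at h
  simpa using h

/-- The trace series of a diagonal map on a graded space with a basis indexed by the monomials in
finitely many variables. -/
theorem traceSeries_mul_eq_one {A : Type v} [Ring A] [Algebra k A] {𝒜 : ℕ → Submodule k A}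
    {f : A →ₗ[k] A} (hf : ∀ d, ∀ a ∈ 𝒜 d, f a ∈ 𝒜 d) {κ : Type w} [Fintype κ] [DecidableEq κ]
    {u : (κ →₀ ℕ) → A} (hu : LinearIndependent k u)
    (hspan : ∀ d, 𝒜 d = Submodule.span k
      (u '' (Finset.finsuppAntidiag (Finset.univ : Finset κ) d : Set (κ →₀ ℕ))))
    {w : κ → k} (hw : ∀ I, f (u I) = (∏ i, w i ^ I i) • u I) :
    traceSeries 𝒜 f hf * ∏ i, (1 - PowerSeries.C (w i) * PowerSeries.X) = 1 := by
  have h : traceSeries 𝒜 f hf = ∏ i, PowerSeries.mk (fun j => w i ^ j) := by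
    ext d
    -- The coefficient of a product of series is a sum over `finsuppAntidiag`, the same set that
    -- indexes the basis in degree `d`.
    rw [PowerSeries.coeff_prod, traceSeries, PowerSeries.coeff_mk,
      trace_restrict_eq_sum hu _ (hspan d) (hf d) hw]
    simp
  rw [h, ← Finset.prod_mul_distrib]
  exact Finset.prod_eq_one fun i _ => mk_pow_mul_one_sub (w i)

end TraceSeries

/-! ### Diagonalization on the linear forms. -/

section Diagonalization

open MvPolynomial

variable {k : Type u} [Field k] {n : ℕ}

/-- In characteristic 0 the polynomial `X ^ N - 1` is separable, and it annihilates `f`. -/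
theorem isSemisimple_of_pow_eq_one [CharZero k] {V : Type v} [AddCommGroup V] [Module k V]
    [FiniteDimensional k V] {f : Module.End k V} {N : ℕ} (hN : 0 < N) (hf : f ^ N = 1) :
    f.IsSemisimple := by
  have hs : (Polynomial.X ^ N - 1 : Polynomial k).Separable :=
    Polynomial.X_pow_sub_one_separable_iff.2 (by exact_mod_cast hN.ne')
  exact Module.End.isSemisimple_of_squarefree_aeval_eq_zero hs.squarefree (by simp [hf])

theorem isInternal_eigenspace [IsAlgClosed k] {V : Type v} [AddCommGroup V] [Module k V]
    [FiniteDimensional k V] {f : Module.End k V} (hf : f.IsSemisimple) {m : ℕ} {ev : Fin m → k}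
    (hinj : Function.Injective ev) (hev : ∀ μ : k, f.HasEigenvalue μ ↔ ∃ j, ev j = μ) :
    DirectSum.IsInternal fun j => f.eigenspace (ev j) := by
  refine DirectSum.isInternal_submodule_of_iSupIndep_of_iSup_eq_top
    (f.eigenspaces_iSupIndep.comp hinj) ?_
  rw [eq_top_iff, ← hf.iSup_eigenspace_eq_top]
  refine iSup_le fun μ => ?_
  by_cases h : f.HasEigenvalue μ
  · obtain ⟨j, rfl⟩ := (hev μ).1 h
    exact le_iSup (fun j => f.eigenspace (ev j)) j
  · rw [Module.End.hasEigenvalue_iff, not_not] at h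
    rw [h]
    exact bot_le

/-- The variables as a basis of the linear forms. -/
noncomputable def basisLinearForms (k : Type u) [Field k] (n : ℕ) :
    Module.Basis (Fin n) k (polyGrading k n 1) :=
  Module.Basis.mk (v := fun i => ⟨X i, isHomogeneous_X k i⟩)
    (LinearIndependent.of_comp (polyGrading k n 1).subtype (linearIndependent_X (Fin n) k)) (by
      rw [← Submodule.map_le_map_iff_of_injective (Submodule.injective_subtype _),
        Submodule.map_span, Submodule.map_top, Submodule.range_subtype, ← Set.range_comp]
      exact fun f hf => mem_span_X_of_mem_one hf)

/-- Every basis of the linear forms is the image of the variables under an automorphism. -/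
theorem exists_algEquiv_of_basis (b : Module.Basis (Fin n) k (polyGrading k n 1)) :
    ∃ ψ : MvPolynomial (Fin n) k ≃ₐ[k] MvPolynomial (Fin n) k,
      (∀ i, ψ (X i) = b i) ∧
      ∀ d, (polyGrading k n d).map ψ.toLinearMap = polyGrading k n d := by
  let g : MvPolynomial (Fin n) k →ₐ[k] MvPolynomial (Fin n) k := aeval fun i => (b i : _)
  have hg : ∀ i, g (X i) = b i := fun i => aeval_X _ i
  have hmap1 : (polyGrading k n 1).map g.toLinearMap = polyGrading k n 1 := by
    conv_lhs => rw [polyGrading, homogeneousSubmodule_one_eq_span_X]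
    rw [Submodule.map_span, ← Set.range_comp]
    have h : g.toLinearMap ∘ X = (polyGrading k n 1).subtype ∘ b := funext hg
    rw [h, Set.range_comp, ← Submodule.map_span, b.span_eq, Submodule.map_top,
      Submodule.range_subtype]
  have hsurj : Function.Surjective g := by
    rw [← AlgHom.range_eq_top, eq_top_iff, ← adjoin_range_X, Algebra.adjoin_le_iff]
    rintro _ ⟨i, rfl⟩
    have h : X i ∈ (polyGrading k n 1).map g.toLinearMap := by
      rw [hmap1]
      exact isHomogeneous_X k i
    obtain ⟨a, _, ha⟩ := h
    exact ⟨a, ha⟩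
  -- The left inverse of `g`: on linear forms it is the linear map sending `b i` to `X i`.
  let g' : MvPolynomial (Fin n) k →ₐ[k] MvPolynomial (Fin n) k :=
    aeval fun i => b.constr k X (basisLinearForms k n i)
  have hg' : g'.toLinearMap ∘ₗ (polyGrading k n 1).subtype = b.constr k X := by
    refine (basisLinearForms k n).ext fun i => ?_
    rw [← aeval_X (R := k) (fun i => b.constr k X (basisLinearForms k n i)) i]
    simp [basisLinearForms, g']
  have hgg' : g'.comp g = AlgHom.id k _ := by
    refine algHom_ext fun i => ?_
    rw [AlgHom.comp_apply, hg]
    exact (LinearMap.congr_fun hg' (b i)).trans (b.constr_basis k X i)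
  have hinj : Function.Injective g :=
    Function.LeftInverse.injective (g := g') (AlgHom.congr_fun hgg')
  refine ⟨AlgEquiv.ofBijective g ⟨hinj, hsurj⟩, hg, fun d => ?_⟩
  change (polyGrading k n d).map g.toLinearMap = _
  rw [polyGrading, ← homogeneousSubmodule_one_pow, Submodule.map_pow, hmap1]

/-- An eigenbasis of an endomorphism of finite order. -/
theorem exists_eigenbasis [IsAlgClosed k] [CharZero k] {V : Type v} [AddCommGroup V] [Module k V]
    [FiniteDimensional k V] {f : Module.End k V}
    {N : ℕ} (hN : 0 < N) (hf : f ^ N = 1) {m : ℕ} {ev : Fin m → k} {c : Fin m → ℕ}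
    (hinj : Function.Injective ev) (hev : ∀ μ : k, f.HasEigenvalue μ ↔ ∃ j, ev j = μ)
    (hc : ∀ j, c j = Module.finrank k (f.eigenspace (ev j))) :
    ∃ b : Module.Basis (Σ j, Fin (c j)) k V, ∀ s, f (b s) = ev s.1 • b s := by
  have hint := isInternal_eigenspace (isSemisimple_of_pow_eq_one hN hf) hinj hev
  exact ⟨hint.collectedBasis fun j =>
      Module.finBasisOfFinrankEq k (f.eigenspace (ev j)) (hc j).symm,
    fun s => Module.End.mem_eigenspace_iff.1 (hint.collectedBasis_mem _ s)⟩

end Diagonalization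

end PoissonStructure

/-! ### The trace formula. -/

open PoissonStructure in
theorem lemma4p3 {k : Type u} [Field k] [IsAlgClosed k] [CharZero k] (n : ℕ)
    (B : PoissonStructure k (MvPolynomial (Fin n) k)) (hB : B.IsQuadratic)
    (φ : MvPolynomial (Fin n) k ≃ₐ[k] MvPolynomial (Fin n) k) (hφ : B.IsGradedPoissonAut φ)
    (hfin : IsOfFinOrder φ)
    (m : ℕ) (ev : Fin m → k) (c : Fin m → ℕ) (hinj : Function.Injective ev)
    (hev : ∀ μ : k, Module.End.HasEigenvalue (φ.toLinearMap.restrict (hφ.mem 1)) μ ↔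
      ∃ j, ev j = μ)
    (hc : ∀ j, c j = Module.finrank k
      (Module.End.eigenspace (φ.toLinearMap.restrict (hφ.mem 1)) (ev j))) :
    PoissonStructure.traceSeries B.envGrading (B.inducedAut φ hφ.isPoissonAut).toLinearMap
        hφ.inducedAut_mem
      = (∏ j, (1 - PowerSeries.C (ev j) * PowerSeries.X) ^ (2 * c j))⁻¹ ∧
    PoissonStructure.traceSeries B.envGrading (B.inducedAut φ hφ.isPoissonAut).toLinearMap
        hφ.inducedAut_mem
      = PoissonStructure.traceSeries (PoissonStructure.polyGrading k n) φ.toLinearMap hφ.mem ^ 2 :=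
  by
  obtain ⟨N, hN, hpow⟩ := isOfFinOrder_iff_pow_eq_one.1 hfin
  have hfN : (φ.toLinearMap.restrict (hφ.mem 1)) ^ N = 1 := by
    have hi : ∀ (j : ℕ) (a : polyGrading k n 1),
        (((φ.toLinearMap.restrict (hφ.mem 1)) ^ j) a : MvPolynomial (Fin n) k) = (φ ^ j) a := by
      intro j
      induction j with
      | zero => intro a; simp
      | succ j ih =>
        intro a
        rw [pow_succ, Module.End.mul_apply, ih, pow_succ]
        rfl
    exact LinearMap.ext fun a => Subtype.ext (by rw [hi, hpow]; rfl)
  have : FiniteDimensional k (polyGrading k n 1) :=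
    (basisLinearForms k n).finiteDimensional_of_finite
  obtain ⟨b, hb⟩ := exists_eigenbasis hN hfN hinj hev hc
  -- The eigenbasis is indexed by pairs (eigenvalue, position in its eigenspace); `e` matches these
  -- with the `n` variables.
  let e := b.indexEquiv (basisLinearForms k n)
  obtain ⟨ψ, hψX, hψ⟩ := exists_algEquiv_of_basis (b.reindex e)
  have hw : ∀ i, φ (ψ (MvPolynomial.X i)) = ev (e.symm i).1 • ψ (MvPolynomial.X i) := fun i => by
    rw [hψX, Module.Basis.reindex_apply]
    exact congrArg Subtype.val (hb (e.symm i))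
  have hU := traceSeries_mul_eq_one (f := (B.inducedAut φ hφ.isPoissonAut).toLinearMap)
    hφ.inducedAut_mem (hB.linearIndependent_pbwMonomial_of_linearChange hψ)
    (hB.envGrading_eq_span_of_linearChange hψ) (inducedAut_pbwMonomial hφ.isPoissonAut hw)
  have hP := traceSeries_mul_eq_one (f := φ.toLinearMap) hφ.mem
    linearIndependent_monomial_of_linearChange (polyGrading_eq_span_of_linearChange hψ)
    (map_monomial_of_eigen (φ := (φ : MvPolynomial (Fin n) k →ₐ[k] _)) hw)
  have hprod : ∏ i, (1 - PowerSeries.C (ev (e.symm i).1) * PowerSeries.X) =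
      ∏ j, (1 - PowerSeries.C (ev j) * PowerSeries.X) ^ c j := by
    rw [Equiv.prod_comp e.symm fun s => (1 - PowerSeries.C (ev s.1) * PowerSeries.X),
      Fintype.prod_sigma]
    simp
  rw [Fintype.prod_sum_type] at hU
  simp only [Sum.elim_inl, Sum.elim_inr] at hU
  rw [hprod] at hU hP
  constructor
  · rw [PowerSeries.eq_inv_iff_mul_eq_one]
    · simp only [two_mul, pow_add]
      rw [Finset.prod_mul_distrib]
      exact hU
    -- The constant coefficient is 1, so `⁻¹` is a genuine inverse of power series.
    · simp
  · generalize (∏ j, (1 - PowerSeries.C (ev j) * PowerSeries.X) ^ c j) = Q at hU hP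
    -- With `T` and `S` the series of `U(P)` and `P`, the inputs are `T Q² = 1` and `S Q = 1`,
    -- whence `T = T (S Q)² = S²`.
    linear_combination (-(traceSeries B.envGrading (B.inducedAut φ hφ.isPoissonAut).toLinearMap
      hφ.inducedAut_mem)) * (traceSeries (polyGrading k n) φ.toLinearMap hφ.mem * Q + 1) * hP
      + traceSeries (polyGrading k n) φ.toLinearMap hφ.mem ^ 2 * hU
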